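/- Let $p\in(0,1)$, $q=1-p$, $H=-p\ln p-q\ln q$ and $H_2=p\ln^2p+q\ln^2q$, and let $\gamma$ be Euler's constant. Let $\Xi^{(1)},\Xi^{(2)},\dots$ be i.i.d. random infinite binary strings whose letters are i.i.d. with $P(1)=p$ and $P(0)=q$. The trie of a finite set of distinct infinite binary strings is the binary tree constructed recursively as follows: the empty set gives the empty tree; a single string gives a single node (the root), in which the string is stored; a set of at least two strings gives a root storing no string, and at level $k$ (the root having level $0$) the strings with $(k+1)$-st letter $0$ are passed to the left subtree and those with $(k+1)$-st letter $1$ to the right subtree, the subtrees being constructed in the same way at level $k+1$. For $n\ge1$ let $D_n$ (the insertion depth) be the depth, i.e. the path length from the root, of the node containing a given one of the strings $\Xi^{(1)},\dots,\Xi^{(n)}$ (for example the first) in the trie constructed from these $n$ strings, which are almost surely distinct. Then $\mathbb E D_n<\infty$ for every $n\ge1$, and the following holds. (i) If $\ln p/\ln q$ is irrational, then, as $n\to\infty$, $$\mathbb E D_n=\frac{\ln n}{H}+\frac{H_2}{2H^2}+\frac{\gamma}{H}+o(1).$$ (ii) If $\ln p/\ln q$ is rational, let $d=\gcd(\ln p,\ln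 q)$ be the largest positive real number such that $\ln p$ and $\ln q$ both are integer multiples of $d$ (such a number exists). Then, as $n\to\infty$, $$\mathbb E D_n=\frac{\ln n}{H}+\frac{H_2}{2H^2}+\frac{\gamma}{H}+\psi(\ln n)+o(1),$$ where $\psi:\mathbb R\to\mathbb R$ is the continuous $d$-periodic function given, for every $t\in\mathbb R$, by the absolutely convergent series $$\psi(t)=-\frac1H\sum_{k\in\mathbb Z,\ k\neq0}\Gamma(-2\pi \mathrm i k/d)\,e^{2\pi \mathrm i kt/d}.$$ -/

import Mathlib

open MeasureTheory ProbabilityTheory Filter Topology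

/-- Infinite strings over the binary alphabet; `false` is the letter 0 and `true` the letter 1.
Letters are numbered from 0. -/
abbrev BinString : Type := ℕ → Bool

/-- Finite binary trees in which strings are stored: the empty tree, a single (external) node
storing a string, or an internal node, storing nothing, with a left and a right subtree. -/
inductive TrieTree : Type where
  | empty : TrieTree
  | leaf (s : BinString) : TrieTree
  | node (l r : TrieTree) : TrieTree

/-- `IsTrieAt k S t`: the recursive trie construction, started at level `k` with the set `S` of
strings, produces the tree `t`. An empty set gives the empty tree and a one-element set a single
node storing the string; a set with at least two strings gives an internal node, the strings whose
letter number `k` is 0 being passed to the left subtree and those whose letter number `k` is 1 to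
the right subtree, which are constructed in the same way at level `k + 1`. -/
inductive IsTrieAt : ℕ → Set BinString → TrieTree → Prop where
  | empty (k : ℕ) : IsTrieAt k ∅ TrieTree.empty
  | leaf (k : ℕ) (s : BinString) : IsTrieAt k {s} (TrieTree.leaf s)
  | node (k : ℕ) (S : Set BinString) (l r : TrieTree) (hS : S.Nontrivial)
      (hl : IsTrieAt (k + 1) {s ∈ S | s k = false} l)
      (hr : IsTrieAt (k + 1) {s ∈ S | s k = true} r) : IsTrieAt k S (TrieTree.node l r)

/-- The construction terminates if the strings are separated by finitely many letters. -/
theorem exists_isTrieAt_of_separated (m : ℕ) : ∀ (k : ℕ) (S : Set BinString),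
    (∀ s ∈ S, ∀ u ∈ S, (∀ j, j < k + m → s j = u j) → s = u) →
    (∀ s ∈ S, ∀ u ∈ S, ∀ j, j < k → s j = u j) → ∃ t, IsTrieAt k S t := by
  induction m with
  | zero =>
    intro k S h1 h2
    have hS : S.Subsingleton := fun s hs u hu => h1 s hs u hu (fun j hj => h2 s hs u hu j hj)
    rcases hS.eq_empty_or_singleton with h | ⟨s, h⟩
    · exact ⟨_, h ▸ IsTrieAt.empty k⟩
    · exact ⟨_, h ▸ IsTrieAt.leaf k s⟩
  | succ m ih =>
    intro k S h1 h2
    rcases S.subsingleton_or_nontrivial with hS | hS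
    · rcases hS.eq_empty_or_singleton with h | ⟨s, h⟩
      · exact ⟨_, h ▸ IsTrieAt.empty k⟩
      · exact ⟨_, h ▸ IsTrieAt.leaf k s⟩
    · have key : ∀ b : Bool, ∃ t, IsTrieAt (k + 1) {s ∈ S | s k = b} t := by
        intro b
        refine ih (k + 1) _ ?_ ?_
        · intro s hs u hu h
          exact h1 s hs.1 u hu.1 (fun j hj => h j (by omega))
        · intro s hs u hu j hj
          rcases Nat.lt_succ_iff_lt_or_eq.mp hj with h | h
          · exact h2 s hs.1 u hu.1 j h
          · subst h; exact hs.2.trans hu.2.symm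
      obtain ⟨l, hl⟩ := key false
      obtain ⟨r, hr⟩ := key true
      exact ⟨_, IsTrieAt.node k S l r hS hl hr⟩

/-- Every finite set of (distinct) strings has a trie. -/
theorem exists_isTrieAt (S : Set BinString) (hS : S.Finite) : ∃ t, IsTrieAt 0 S t := by
  classical
  have h : ∃ m : ℕ, ∀ s ∈ S, ∀ u ∈ S, (∀ j, j < m → s j = u j) → s = u := by
    have hd : ∀ x : BinString × BinString, ∃ m : ℕ, (∀ j, j < m → x.1 j = x.2 j) → x.1 = x.2 := by
      intro x
      by_cases hx : x.1 = x.2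
      · exact ⟨0, fun _ => hx⟩
      · obtain ⟨j, hj⟩ := Function.ne_iff.mp hx
        exact ⟨j + 1, fun h => absurd (h j (Nat.lt_succ_self j)) hj⟩
    choose f hf using hd
    obtain ⟨M, hM⟩ := ((hS.prod hS).image f).bddAbove
    refine ⟨M, fun s hs u hu h => hf (s, u) (fun j hj => h j (lt_of_lt_of_le hj ?_))⟩
    exact hM ⟨(s, u), ⟨hs, hu⟩, rfl⟩
  obtain ⟨m, hm⟩ := h
  exact exists_isTrieAt_of_separated m 0 S (by simpa using hm) (by simp)

/-- The tree produced by the construction is unique. -/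
theorem IsTrieAt.unique {k : ℕ} {S : Set BinString} {t t' : TrieTree}
    (h : IsTrieAt k S t) (h' : IsTrieAt k S t') : t = t' := by
  induction h generalizing t' with
  | empty k =>
    generalize hE : (∅ : Set BinString) = E at h'
    cases h' with
    | empty => rfl
    | leaf _ s => exact absurd hE.symm (Set.singleton_ne_empty s)
    | node _ _ l r hS => subst hE; exact absurd hS Set.not_nontrivial_empty
  | leaf k s =>
    generalize hE : ({s} : Set BinString) = E at h'
    cases h' with
    | empty => exact absurd hE (Set.singleton_ne_empty s)
    | leaf _ u => rw [Set.singleton_eq_singleton_iff.mp hE]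
    | node _ _ l r hS => subst hE; exact absurd hS Set.not_nontrivial_singleton
  | node k S l r hS hl hr ihl ihr =>
    cases h' with
    | empty => exact absurd hS Set.not_nontrivial_empty
    | leaf _ u => exact absurd hS Set.not_nontrivial_singleton
    | node _ _ l' r' _ hl' hr' => rw [ihl hl', ihr hr']

/-- The trie constructed from a finite set of strings. -/
noncomputable def trieOf (S : Set BinString) (hS : S.Finite) : TrieTree :=
  (exists_isTrieAt S hS).choose

open Classical in
/-- The depth (path length from the root) of the node that stores `s`; `none` if there is no such
node. -/
noncomputable def TrieTree.depth? (s : BinString) : TrieTree → Option ℕ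
  | .empty => none
  | .leaf u => if u = s then some 0 else none
  | .node l r => ((l.depth? s).or (r.depth? s)).map (· + 1)

/-- Every string of the set is stored in its trie, so that it does have a depth. -/
theorem IsTrieAt.isSome_depth? {k : ℕ} {S : Set BinString} {t : TrieTree} (h : IsTrieAt k S t)
    {s : BinString} (hs : s ∈ S) : (t.depth? s).isSome := by
  induction h with
  | empty k => exact absurd hs (Set.notMem_empty s)
  | leaf k u => rw [Set.mem_singleton_iff] at hs; simp [TrieTree.depth?, hs]
  | node k S l r hS hl hr ihl ihr =>
    cases hb : s k with
    | false => simp [TrieTree.depth?, ihl ⟨hs, hb⟩]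
    | true => simp [TrieTree.depth?, ihr ⟨hs, hb⟩]

/-- The depth of the node containing the string `x i` in the trie constructed from the `n` strings
`x 0, …, x (n - 1)` (meaningful for `i < n`). -/
noncomputable def insertionDepth (x : ℕ → BinString) (n i : ℕ) : ℕ :=
  ((trieOf (x '' Set.Iio n) ((Set.finite_Iio n).image x)).depth? (x i)).getD 0

/-- The entropy `H = -p ln p - q ln q`, where `q = 1 - p`. -/
noncomputable def letterEntropy (p : ℝ) : ℝ :=
  -p * Real.log p - (1 - p) * Real.log (1 - p)

/-- The second moment `H₂ = p ln² p + q ln² q`, where `q = 1 - p`. -/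
noncomputable def letterSecondMoment (p : ℝ) : ℝ :=
  p * Real.log p ^ 2 + (1 - p) * Real.log (1 - p) ^ 2

/-- `d = gcd(x, y)`: the largest positive real number such that `x` and `y` both are integer
multiples of `d`. -/
def IsRealGcd (x y d : ℝ) : Prop :=
  IsGreatest {e : ℝ | 0 < e ∧ (∃ a : ℤ, x = a * e) ∧ ∃ b : ℤ, y = b * e} d

/-! Almost surely the depth of a string exceeds m exactly when another string shares its first m
letters. Conditioning on that prefix and summing the tails gives E Dₙ = ∑ₘ ∑_w P(w)(1 - (1 -
P(w))^(n-1)), with w running over the words of length m. This is the potential ∑ₘ Bᵐf at 1, where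
Bf(x) = p f(px) + q f(qx) and f is `trieWeight n`.

Since B multiplies the identity by p² + q² < 1, dominated convergence allows (1 - x)^(n-1) to be
replaced by e^(-nx) at the cost of o(1) (`tendsto_splitSum_trieWeight_sub`). The new potential F,
evaluated at n, satisfies F(x) = 1 - e^(-x) + pF(px) + qF(qx). With a = -ln p, b = -ln q, the error
K(t) = F(eᵗ) - t/H therefore solves the renewal equation K(t) = pK(t-a) + qK(t-b) - exp(-eᵗ), whose
inhomogeneity vanishes at infinity.

Comparison with the bounded function x/(1+x) makes K uniformly continuous on the line and bounded on
[0, ∞). A renewal theorem (`exists_tendsto_cosetAtTop`) then gives convergence of K along each coset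
of the closed group generated by a and b: where -K is nearly its limit superior, so are its backward
translates by ja + kb. These translates fill a whole window, and the bound on a window propagates
forward. In the irrational case the group is all of ℝ and K converges; in the rational case it
contains d, and K is asymptotic to a continuous d-periodic κ.

It remains to identify the limit. For a character e invariant under both steps, with antiderivative
E, averaging F(eˢ)e(s) over windows of lengths a and b produces a function with derivative (1 -
exp(-eᵗ))e(t). Integrating over the line expresses the moments of κ through ∫ E(t) exp(t - eᵗ) dt.
For e = 1 this is Γ'(1) = -γ and yields the constant; for e = exp(θt) it is Γ(θ) and yields the
Fourier coefficients, which are summable. -/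

/-! ### The splitting operator -/

/-- The splitting operator `f ↦ (x ↦ p f(p x) + q f(q x))`, where `q = 1 - p`. -/
def splitOp (p : ℝ) (f : ℝ → ℝ) : ℝ → ℝ := fun x => p * f (p * x) + (1 - p) * f ((1 - p) * x)

/-- The potential `∑ₘ Bᵐ f` of the splitting operator `B`. -/
noncomputable def splitSum (p : ℝ) (f : ℝ → ℝ) (x : ℝ) : ℝ := ∑' m : ℕ, (splitOp p)^[m] f x

section SplitOp

variable {p : ℝ}

theorem splitOp_iterate_succ (m : ℕ) (f : ℝ → ℝ) (x : ℝ) :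
    (splitOp p)^[m + 1] f x =
      p * (splitOp p)^[m] f (p * x) + (1 - p) * (splitOp p)^[m] f ((1 - p) * x) := by
  rw [Function.iterate_succ_apply']; rfl

theorem splitOp_iterate_mono (hp0 : 0 < p) (hp1 : p < 1) {f g : ℝ → ℝ} (m : ℕ) :
    ∀ {x : ℝ}, 0 ≤ x → (∀ y, 0 ≤ y → y ≤ x → f y ≤ g y) →
      (splitOp p)^[m] f x ≤ (splitOp p)^[m] g x := by
  induction m with
  | zero => intro x hx h; exact h x hx le_rfl
  | succ m ih =>
    intro x hx h
    rw [splitOp_iterate_succ, splitOp_iterate_succ]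
    have h1 : p * x ≤ x := mul_le_of_le_one_left hx hp1.le
    have h2 : (1 - p) * x ≤ x := mul_le_of_le_one_left hx (by linarith)
    have h3 := ih (x := p * x) (by positivity) fun y hy hyx => h y hy (hyx.trans h1)
    have h4 := ih (x := (1 - p) * x) (mul_nonneg (by linarith) hx)
      fun y hy hyx => h y hy (hyx.trans h2)
    have h5 : 0 ≤ 1 - p := by linarith
    gcongr

theorem splitOp_iterate_sub (f g : ℝ → ℝ) (m : ℕ) (x : ℝ) :
    (splitOp p)^[m] (fun y => f y - g y) x = (splitOp p)^[m] f x - (splitOp p)^[m] g x := by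
  induction m generalizing x with
  | zero => rfl
  | succ m ih => simp only [splitOp_iterate_succ, ih]; ring

theorem splitOp_iterate_const_mul (c : ℝ) (f : ℝ → ℝ) (m : ℕ) (x : ℝ) :
    (splitOp p)^[m] (fun y => c * f y) x = c * (splitOp p)^[m] f x := by
  induction m generalizing x with
  | zero => rfl
  | succ m ih => simp only [splitOp_iterate_succ, ih]; ring

theorem splitOp_iterate_comp_mul (c : ℝ) (f : ℝ → ℝ) (m : ℕ) (x : ℝ) :
    (splitOp p)^[m] (fun y => f (c * y)) x = (splitOp p)^[m] f (c * x) := by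
  induction m generalizing x with
  | zero => rfl
  | succ m ih =>
    simp only [splitOp_iterate_succ, ih, mul_left_comm]

/-- The identity is an eigenfunction with eigenvalue p² + q² < 1. Hence any weight bounded by C·y
has a geometrically convergent potential, which is the source of every summability statement below.
-/
theorem splitOp_iterate_id (m : ℕ) (x : ℝ) :
    (splitOp p)^[m] (fun y => y) x = (p ^ 2 + (1 - p) ^ 2) ^ m * x := by
  induction m generalizing x with
  | zero => simp
  | succ m ih => rw [splitOp_iterate_succ, ih, ih]; ring

theorem splitOp_iterate_linear (C : ℝ) (m : ℕ) (x : ℝ) :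
    (splitOp p)^[m] (fun y => C * y) x = C * ((p ^ 2 + (1 - p) ^ 2) ^ m * x) :=
  (splitOp_iterate_const_mul C (fun y => y) m x).trans (by rw [splitOp_iterate_id])

theorem splitOp_iterate_zero (m : ℕ) (x : ℝ) : (splitOp p)^[m] (fun _ => 0) x = 0 := by
  induction m generalizing x with
  | zero => rfl
  | succ m ih => simp [splitOp_iterate_succ, ih]

theorem splitOp_iterate_nonneg (hp0 : 0 < p) (hp1 : p < 1) {f : ℝ → ℝ} (m : ℕ) {x : ℝ}
    (hx : 0 ≤ x) (hf : ∀ y, 0 ≤ y → y ≤ x → 0 ≤ f y) : 0 ≤ (splitOp p)^[m] f x := by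
  simpa [splitOp_iterate_zero] using splitOp_iterate_mono hp0 hp1 (f := fun _ => 0) m hx hf

theorem abs_splitOp_iterate_le (hp0 : 0 < p) (hp1 : p < 1) {f g : ℝ → ℝ} (m : ℕ) {x : ℝ}
    (hx : 0 ≤ x) (hf : ∀ y, 0 ≤ y → y ≤ x → |f y| ≤ g y) :
    |(splitOp p)^[m] f x| ≤ (splitOp p)^[m] g x := by
  rw [abs_le]
  constructor
  · have := splitOp_iterate_mono hp0 hp1 (f := fun y => (-1) * g y) (g := f) m hx
      fun y hy hyx => by linarith [(abs_le.1 (hf y hy hyx)).1]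
    rw [splitOp_iterate_const_mul] at this
    linarith
  · exact splitOp_iterate_mono hp0 hp1 m hx fun y hy hyx => (abs_le.1 (hf y hy hyx)).2

theorem tendsto_splitOp_iterate (hp0 : 0 < p) (hp1 : p < 1) {ι : Type*} {l : Filter ι}
    {f : ι → ℝ → ℝ} {g : ℝ → ℝ} (m : ℕ) : ∀ {x : ℝ}, 0 ≤ x →
    (∀ y, 0 ≤ y → y ≤ x → Tendsto (fun i => f i y) l (𝓝 (g y))) →
      Tendsto (fun i => (splitOp p)^[m] (f i) x) l (𝓝 ((splitOp p)^[m] g x)) := by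
  induction m with
  | zero => intro x hx h; exact h x hx le_rfl
  | succ m ih =>
    intro x hx h
    simp only [splitOp_iterate_succ]
    have h1 : p * x ≤ x := mul_le_of_le_one_left hx hp1.le
    have h2 : (1 - p) * x ≤ x := mul_le_of_le_one_left hx (by linarith)
    exact ((ih (x := p * x) (by positivity) fun y hy hyx => h y hy (hyx.trans h1)).const_mul _).add
      ((ih (x := (1 - p) * x) (mul_nonneg (by linarith) hx)
        fun y hy hyx => h y hy (hyx.trans h2)).const_mul _)

theorem sq_add_sq_one_sub_nonneg : 0 ≤ p ^ 2 + (1 - p) ^ 2 := by positivity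

theorem sq_add_sq_one_sub_lt_one (hp0 : 0 < p) (hp1 : p < 1) : p ^ 2 + (1 - p) ^ 2 < 1 := by
  nlinarith

theorem summable_splitOp_iterate_id (hp0 : 0 < p) (hp1 : p < 1) (C x : ℝ) :
    Summable fun m : ℕ => (splitOp p)^[m] (fun y => C * y) x := by
  simp only [splitOp_iterate_linear]
  exact ((summable_geometric_of_lt_one sq_add_sq_one_sub_nonneg
    (sq_add_sq_one_sub_lt_one hp0 hp1)).mul_right x).mul_left C

theorem summable_splitOp_iterate (hp0 : 0 < p) (hp1 : p < 1) {f : ℝ → ℝ} {C x : ℝ}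
    (hx : 0 ≤ x) (hf : ∀ y, 0 ≤ y → y ≤ x → |f y| ≤ C * y) :
    Summable fun m : ℕ => (splitOp p)^[m] f x :=
  Summable.of_norm_bounded (summable_splitOp_iterate_id hp0 hp1 C x)
    fun m => abs_splitOp_iterate_le hp0 hp1 m hx hf

theorem splitSum_eq (hp0 : 0 < p) (hp1 : p < 1) {f : ℝ → ℝ} {C x : ℝ}
    (hx : 0 ≤ x) (hf : ∀ y, 0 ≤ y → y ≤ x → |f y| ≤ C * y) :
    splitSum p f x = f x + (p * splitSum p f (p * x) + (1 - p) * splitSum p f ((1 - p) * x)) := by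
  have h1 : p * x ≤ x := mul_le_of_le_one_left hx hp1.le
  have h2 : (1 - p) * x ≤ x := mul_le_of_le_one_left hx (by linarith)
  have s1 := summable_splitOp_iterate hp0 hp1 (x := p * x) (by positivity)
    fun y hy hyx => hf y hy (hyx.trans h1)
  have s2 := summable_splitOp_iterate hp0 hp1 (x := (1 - p) * x) (mul_nonneg (by linarith) hx)
    fun y hy hyx => hf y hy (hyx.trans h2)
  have s0 := summable_splitOp_iterate hp0 hp1 hx hf
  unfold splitSum
  rw [s0.tsum_eq_zero_add, ← tsum_mul_left, ← tsum_mul_left,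
    ← (s1.mul_left p).tsum_add (s2.mul_left (1 - p))]
  simp only [splitOp_iterate_succ, Function.iterate_zero, id_eq]

theorem splitSum_le_of_abs_le (hp0 : 0 < p) (hp1 : p < 1) {f : ℝ → ℝ} {C x : ℝ}
    (hx : 0 ≤ x) (hf : ∀ y, 0 ≤ y → y ≤ x → |f y| ≤ C * y) :
    |splitSum p f x| ≤ C / (1 - (p ^ 2 + (1 - p) ^ 2)) * x := by
  have h0 := summable_splitOp_iterate_id hp0 hp1 C x
  have h1 := tsum_of_norm_bounded (f := fun m => (splitOp p)^[m] f x) h0.hasSum fun m =>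
    abs_splitOp_iterate_le hp0 hp1 (g := fun y => C * y) m hx hf
  refine h1.trans (le_of_eq ?_)
  simp only [splitOp_iterate_linear]
  rw [tsum_mul_left, tsum_mul_right, tsum_geometric_of_lt_one sq_add_sq_one_sub_nonneg
    (sq_add_sq_one_sub_lt_one hp0 hp1)]
  ring

/-- A nonnegative supersolution bounds the potential. -/
theorem splitSum_le_of_supersolution (hp0 : 0 < p) (hp1 : p < 1) {f S : ℝ → ℝ} {x : ℝ}
    (hx : 0 ≤ x) (hf0 : ∀ y, 0 ≤ y → 0 ≤ f y) (hS0 : ∀ y, 0 ≤ y → 0 ≤ S y)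
    (hf : ∀ y, 0 ≤ y → f y ≤ S y - splitOp p S y) : splitSum p f x ≤ S x := by
  -- Applying the monotone operator Bᵐ to f ≤ S - BS makes the partial sums telescope to at most S -
  -- BᴺS ≤ S.
  have key : ∀ m, (splitOp p)^[m] f x ≤ (splitOp p)^[m] S x - (splitOp p)^[m + 1] S x := by
    intro m
    have := splitOp_iterate_mono hp0 hp1 (g := fun y => S y - splitOp p S y) m hx
      fun y hy _ => hf y hy
    rwa [splitOp_iterate_sub, ← Function.iterate_succ_apply] at this
  refine Real.tsum_le_of_sum_range_le
    (fun m => splitOp_iterate_nonneg hp0 hp1 m hx fun y hy _ => hf0 y hy) fun N => ?_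
  refine (Finset.sum_le_sum fun m _ => key m).trans ?_
  rw [Finset.sum_range_sub']
  have := splitOp_iterate_nonneg hp0 hp1 N hx (f := S) fun y hy _ => hS0 y hy
  simp only [Function.iterate_zero, id_eq]
  linarith

/-- The function x/(1+x) is a supersolution bounded by 1. It bounds potentials uniformly in x,
whereas comparison with the identity only gives linear growth. -/
theorem logistic_sub_splitOp (hp0 : 0 < p) (hp1 : p < 1) {x : ℝ} (hx : 0 ≤ x) :
    2 * (p * (1 - p)) * (x / (1 + x) ^ 2) ≤
      x / (1 + x) - splitOp p (fun y => y / (1 + y)) x := by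
  have hq : 0 < 1 - p := by linarith
  have e1 : x / (1 + x) - p * x / (1 + p * x) = (1 - p) * x / ((1 + x) * (1 + p * x)) := by
    field_simp; ring
  have e2 : x / (1 + x) - (1 - p) * x / (1 + (1 - p) * x) =
      p * x / ((1 + x) * (1 + (1 - p) * x)) := by
    have : 0 < 1 + (1 - p) * x := by positivity
    field_simp; ring
  have b1 : (1 - p) * x / (1 + x) ^ 2 ≤ (1 - p) * x / ((1 + x) * (1 + p * x)) := by
    rw [pow_two]; gcongr; nlinarith
  have b2 : p * x / (1 + x) ^ 2 ≤ p * x / ((1 + x) * (1 + (1 - p) * x)) := by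
    rw [pow_two]; gcongr; nlinarith
  calc 2 * (p * (1 - p)) * (x / (1 + x) ^ 2)
      = p * ((1 - p) * x / (1 + x) ^ 2) + (1 - p) * (p * x / (1 + x) ^ 2) := by ring
    _ ≤ p * (x / (1 + x) - p * x / (1 + p * x)) +
        (1 - p) * (x / (1 + x) - (1 - p) * x / (1 + (1 - p) * x)) := by rw [e1, e2]; gcongr
    _ = _ := by unfold splitOp; ring

theorem splitSum_le_of_le_logistic (hp0 : 0 < p) (hp1 : p < 1) {f : ℝ → ℝ} {C x : ℝ}
    (hx : 0 ≤ x) (hf0 : ∀ y, 0 ≤ y → 0 ≤ f y)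
    (hf : ∀ y, 0 ≤ y → f y ≤ C * (y / (1 + y) ^ 2)) :
    splitSum p f x ≤ C / (2 * (p * (1 - p))) := by
  have hq : 0 < 1 - p := by linarith
  have hC : 0 ≤ C := by
    have h1 := hf 1 zero_le_one
    have h2 := hf0 1 zero_le_one
    norm_num at h1; linarith
  set c := C / (2 * (p * (1 - p))) with hc
  have hc0 : 0 ≤ c := by positivity
  have h := splitSum_le_of_supersolution hp0 hp1 (f := f) (S := fun y => c * (y / (1 + y))) hx hf0
    (fun y hy => by positivity) fun y hy => ?_
  · refine h.trans (mul_le_of_le_one_right hc0 ?_)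
    rw [div_le_one (by positivity)]; linarith
  · have h1 := logistic_sub_splitOp hp0 hp1 hy
    have h2 := mul_le_mul_of_nonneg_left h1 hc0
    have h3 : c * (2 * (p * (1 - p)) * (y / (1 + y) ^ 2)) = C * (y / (1 + y) ^ 2) := by
      rw [hc]; field_simp
    have h4 : splitOp p (fun y => c * (y / (1 + y))) y = c * splitOp p (fun y => y / (1 + y)) y :=
      splitOp_iterate_const_mul c (fun y => y / (1 + y)) 1 y
    rw [h4]
    linarith [hf y hy]

end SplitOp

/-! ### The Poissonized sum -/

/-- The weight function of the Poissonized model. -/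
noncomputable def poissonWeight (x : ℝ) : ℝ := 1 - Real.exp (-x)

theorem poissonWeight_nonneg {x : ℝ} (hx : 0 ≤ x) : 0 ≤ poissonWeight x := by
  unfold poissonWeight; linarith [Real.exp_le_one_iff.2 (neg_nonpos.2 hx)]

theorem abs_poissonWeight_le {x : ℝ} (hx : 0 ≤ x) : |poissonWeight x| ≤ 1 * x := by
  rw [abs_of_nonneg (poissonWeight_nonneg hx)]
  unfold poissonWeight; linarith [Real.add_one_le_exp (-x)]

theorem exp_neg_mul_le_logistic {x : ℝ} (hx : 0 ≤ x) :
    Real.exp (-x) ≤ 2 / (1 + x) ^ 2 := by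
  rw [Real.exp_neg, inv_eq_one_div, div_le_div_iff₀ (Real.exp_pos x) (by positivity)]
  nlinarith [Real.quadratic_le_exp_of_nonneg hx]

/-- The potential of the Poisson weight: the mean insertion depth in the Poissonized model. -/
noncomputable def poissonDepth (p x : ℝ) : ℝ := splitSum p poissonWeight x

section PoissonDepth

variable {p : ℝ}

theorem poissonDepth_eq (hp0 : 0 < p) (hp1 : p < 1) {x : ℝ} (hx : 0 ≤ x) :
    poissonDepth p x = (1 - Real.exp (-x)) +
      (p * poissonDepth p (p * x) + (1 - p) * poissonDepth p ((1 - p) * x)) :=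
  splitSum_eq hp0 hp1 hx fun _ hy _ => abs_poissonWeight_le hy

theorem abs_poissonDepth_le (hp0 : 0 < p) (hp1 : p < 1) {x : ℝ} (hx : 0 ≤ x) :
    |poissonDepth p x| ≤ 1 / (1 - (p ^ 2 + (1 - p) ^ 2)) * x :=
  splitSum_le_of_abs_le hp0 hp1 hx fun _ hy _ => abs_poissonWeight_le hy

/-- The difference is itself a potential, of the weight e^(-y)(1 - e^(-(c-1)y)) ≤ 2(c-1) y/(1+y)²,
so the logistic comparison applies. Uniformity in x turns into a modulus of continuity on the
logarithmic scale. -/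
theorem poissonDepth_mul_sub (hp0 : 0 < p) (hp1 : p < 1) {x c : ℝ} (hx : 0 ≤ x) (hc : 1 ≤ c) :
    0 ≤ poissonDepth p (c * x) - poissonDepth p x ∧
      poissonDepth p (c * x) - poissonDepth p x ≤ (c - 1) / (p * (1 - p)) := by
  have hc0 : 0 ≤ c := by linarith
  set f : ℝ → ℝ := fun y => poissonWeight (c * y) - poissonWeight y with hf
  have hfe : ∀ y, f y = Real.exp (-y) * (1 - Real.exp (-((c - 1) * y))) := by
    intro y
    simp only [hf, poissonWeight, mul_sub, ← Real.exp_add]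
    ring_nf
  have e : poissonDepth p (c * x) - poissonDepth p x = splitSum p f x := by
    unfold poissonDepth splitSum
    rw [← (summable_splitOp_iterate hp0 hp1 (mul_nonneg hc0 hx)
      fun _ hy _ => abs_poissonWeight_le hy).tsum_sub
      (summable_splitOp_iterate hp0 hp1 hx fun _ hy _ => abs_poissonWeight_le hy)]
    simp only [hf, splitOp_iterate_sub, splitOp_iterate_comp_mul]
  have hf0 : ∀ y, 0 ≤ y → 0 ≤ f y := by
    intro y hy
    rw [hfe]
    have := poissonWeight_nonneg (x := (c - 1) * y) (mul_nonneg (by linarith) hy)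
    unfold poissonWeight at this
    positivity
  rw [e]
  constructor
  · exact tsum_nonneg fun m => splitOp_iterate_nonneg hp0 hp1 m hx fun y hy _ => hf0 y hy
  · refine (splitSum_le_of_le_logistic hp0 hp1 hx hf0 (C := 2 * (c - 1)) fun y hy => ?_).trans
      (le_of_eq (mul_div_mul_left _ _ two_ne_zero))
    rw [hfe]
    have h1 : 1 - Real.exp (-((c - 1) * y)) ≤ (c - 1) * y := by
      linarith [Real.add_one_le_exp (-((c - 1) * y))]
    calc Real.exp (-y) * (1 - Real.exp (-((c - 1) * y)))
        ≤ 2 / (1 + y) ^ 2 * ((c - 1) * y) := by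
          have := exp_neg_mul_le_logistic hy
          have h3 : 0 ≤ 1 - Real.exp (-((c - 1) * y)) := by
            have := poissonWeight_nonneg (x := (c - 1) * y) (mul_nonneg (by linarith) hy)
            exact this
          gcongr
      _ = _ := by ring

end PoissonDepth

/-! ### Depoissonization -/

/-- The weight function for `n` strings. -/
noncomputable def trieWeight (n : ℕ) (x : ℝ) : ℝ := 1 - (1 - x) ^ (n - 1)

/-- What matters is a bound linear in x with a constant free of n: it supplies the dominating series
for depoissonization. -/
theorem abs_trieWeight_sub_le {n : ℕ} (hn : 1 ≤ n) {x : ℝ} (hx : 0 ≤ x) (hx1 : x ≤ 1) :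
    |trieWeight n x - poissonWeight (n * x)| ≤ x := by
  obtain ⟨k, rfl⟩ := Nat.exists_eq_add_of_le hn
  simp only [trieWeight, poissonWeight, Nat.add_sub_cancel_left]
  push_cast
  have e : Real.exp (-((1 + k : ℝ) * x)) = Real.exp (-x) * Real.exp (-(k * x)) := by
    rw [← Real.exp_add]; ring_nf
  have ek : Real.exp (-(k * x)) = Real.exp (-x) ^ k := by
    rw [← Real.exp_nat_mul]; ring_nf
  have h1 : (1 - x) ^ k ≤ Real.exp (-(k * x)) := by
    rw [ek]
    exact pow_le_pow_left₀ (by linarith) (by linarith [Real.add_one_le_exp (-x)]) k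
  have h2 : Real.exp (-(k * x)) ≤ 1 := Real.exp_le_one_iff.2 (by simp; positivity)
  have h3 : Real.exp (-x) ≤ 1 := Real.exp_le_one_iff.2 (by simpa)
  have h3' : 1 - x ≤ Real.exp (-x) := by linarith [Real.add_one_le_exp (-x)]
  -- From (1+x)e^(-x) ≤ 1 and Bernoulli, (1-x)ᵏ ≥ (1-x²)ᵏe^(-kx) ≥ (1-kx²)e^(-kx). The gap is thus
  -- at most x·(kx)e^(-kx) ≤ x.
  have h4 : Real.exp (-(k * x)) - (1 - x) ^ k ≤ x := by
    have b : 1 - k * x ^ 2 ≤ (1 - x ^ 2) ^ k := by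
      have := one_add_mul_le_pow (a := -x ^ 2) (by nlinarith) k
      calc 1 - k * x ^ 2 = 1 + k * (-x ^ 2) := by ring
        _ ≤ _ := this
        _ = _ := by ring
    have b2 : (1 - x ^ 2) ^ k * Real.exp (-(k * x)) ≤ (1 - x) ^ k := by
      rw [ek, ← mul_pow]
      refine pow_le_pow_left₀ (mul_nonneg (by nlinarith) (Real.exp_pos _).le) ?_ k
      have : (1 + x) * Real.exp (-x) ≤ 1 := by
        have := Real.add_one_le_exp x
        calc (1 + x) * Real.exp (-x) ≤ Real.exp x * Real.exp (-x) := by gcongr; linarith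
          _ = 1 := by rw [← Real.exp_add]; simp
      calc (1 - x ^ 2) * Real.exp (-x) = (1 - x) * ((1 + x) * Real.exp (-x)) := by ring
        _ ≤ (1 - x) * 1 := by gcongr
        _ = _ := mul_one _
    have b3 : (k * x) * Real.exp (-(k * x)) ≤ 1 := by
      have := Real.add_one_le_exp (k * x)
      calc (k * x) * Real.exp (-(k * x)) ≤ Real.exp (k * x) * Real.exp (-(k * x)) := by
            gcongr; linarith
        _ = 1 := by rw [← Real.exp_add]; simp
    have b4 := mul_le_mul_of_nonneg_right b (Real.exp_pos (-(k * x))).le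
    have b5 := mul_le_mul_of_nonneg_left b3 hx
    nlinarith
  rw [e, abs_le]
  constructor
  · nlinarith [Real.exp_pos (-(k * x))]
  · nlinarith [Real.exp_pos (-(k * x))]

theorem tendsto_trieWeight_sub {x : ℝ} (hx : 0 ≤ x) (hx1 : x ≤ 1) :
    Tendsto (fun n : ℕ => trieWeight n x - poissonWeight (n * x)) atTop (𝓝 0) := by
  rcases hx.eq_or_lt with rfl | hx
  · simp [trieWeight, poissonWeight]
  · have h1 : Tendsto (fun n : ℕ => (1 - x) ^ (n - 1)) atTop (𝓝 0) :=
      (tendsto_pow_atTop_nhds_zero_of_lt_one (by linarith) (by linarith)).comp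
        (tendsto_sub_atTop_nat 1)
    have h2 : Tendsto (fun n : ℕ => Real.exp (-(n * x))) atTop (𝓝 0) :=
      Real.tendsto_exp_neg_atTop_nhds_zero.comp (tendsto_natCast_atTop_atTop.atTop_mul_const hx)
    simpa [trieWeight, poissonWeight] using h2.sub h1

theorem abs_trieWeight_le {n : ℕ} {x : ℝ} (hx : 0 ≤ x) (hx1 : x ≤ 1) :
    |trieWeight n x| ≤ n * x := by
  unfold trieWeight
  have h1 : (1 - x) ^ (n - 1) ≤ 1 := pow_le_one₀ (by linarith) (by linarith)
  rw [abs_of_nonneg (by linarith)]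
  have h2 := one_add_mul_le_pow (a := -x) (by linarith) (n - 1)
  have h3 : ((n - 1 : ℕ) : ℝ) ≤ n := by exact_mod_cast Nat.sub_le n 1
  have h4 := mul_le_mul_of_nonneg_right h3 hx
  have : (1 + -x) ^ (n - 1) = (1 - x) ^ (n - 1) := by ring
  linarith

/-- Depoissonization by dominated convergence in m: each term tends to 0 because it is a finite
combination of values at points of [0,1], and it is dominated by (p²+q²)ᵐ. -/
theorem tendsto_splitSum_trieWeight_sub {p : ℝ} (hp0 : 0 < p) (hp1 : p < 1) :
    Tendsto (fun n : ℕ => splitSum p (trieWeight n) 1 - poissonDepth p n) atTop (𝓝 0) := by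
  have e : ∀ n : ℕ, splitSum p (trieWeight n) 1 - poissonDepth p n =
      ∑' m : ℕ, (splitOp p)^[m] (fun x => trieWeight n x - poissonWeight (n * x)) 1 := by
    intro n
    have h := summable_splitOp_iterate hp0 hp1 (f := poissonWeight) (C := 1) (x := n)
      (Nat.cast_nonneg n) fun _ hy _ => abs_poissonWeight_le hy
    have h' := summable_splitOp_iterate hp0 hp1 (f := trieWeight n) (C := n) (x := 1)
      zero_le_one fun _ hy hy1 => abs_trieWeight_le hy hy1
    simp only [splitOp_iterate_sub, splitOp_iterate_comp_mul, mul_one]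
    exact (h'.tsum_sub h).symm
  simp only [e]
  have key := tendsto_tsum_of_dominated_convergence (𝓕 := (atTop : Filter ℕ))
    (f := fun n m => (splitOp p)^[m] (fun x => trieWeight n x - poissonWeight (n * x)) 1)
    (g := fun _ => 0) (summable_splitOp_iterate_id hp0 hp1 1 1) ?_ ?_
  · simpa using key
  · intro m
    have := tendsto_splitOp_iterate hp0 hp1 (l := atTop)
      (f := fun (n : ℕ) x => trieWeight n x - poissonWeight (n * x)) (g := fun _ => 0) m
      zero_le_one fun y hy hy1 => tendsto_trieWeight_sub hy hy1
    rwa [splitOp_iterate_zero] at this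
  · filter_upwards [eventually_ge_atTop 1] with n hn m
    exact abs_splitOp_iterate_le hp0 hp1 m zero_le_one fun y hy hy1 => by
      simpa using abs_trieWeight_sub_le hn hy hy1

/-! ### A renewal theorem for a step distribution with two atoms -/

/-- A lower bound for a supersolution of the renewal equation on a window persists. -/
theorem renewal_forward {a b p m T : ℝ} {V : ℝ → ℝ} (ha : 0 < a) (hb : 0 < b)
    (hp0 : 0 < p) (hp1 : p < 1) {D : Set ℝ} (hDa : ∀ t ∈ D, t - a ∈ D) (hDb : ∀ t ∈ D, t - b ∈ D)
    (hsup : ∀ t ∈ D, T ≤ t → p * V (t - a) + (1 - p) * V (t - b) ≤ V t)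
    (hwin : ∀ t ∈ D, T - max a b ≤ t → t ≤ T → m ≤ V t) :
    ∀ t ∈ D, T - max a b ≤ t → m ≤ V t := by
  have hc : 0 < min a b := lt_min ha hb
  -- The controlled strip grows by `min a b` at each step: for t ≥ T both t - a and t - b lie above
  -- T - `max a b` and inside the previous strip.
  have key : ∀ n : ℕ, ∀ t ∈ D, T - max a b ≤ t → t ≤ T + n * min a b → m ≤ V t := by
    intro n
    induction n with
    | zero => intro t ht h1 h2; exact hwin t ht h1 (by simpa using h2)
    | succ n ih =>
      intro t ht h1 h2
      rcases le_total t T with h | h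
      · exact hwin t ht h1 h
      · push_cast at h2
        have h3 := ih (t - a) (hDa t ht) (by linarith [le_max_left a b])
          (by linarith [min_le_left a b])
        have h4 := ih (t - b) (hDb t ht) (by linarith [le_max_right a b])
          (by linarith [min_le_right a b])
        have h5 := hsup t ht h
        nlinarith
  intro t ht h1
  obtain ⟨n, hn⟩ := exists_nat_ge ((t - T) / min a b)
  rw [div_le_iff₀ hc] at hn
  exact key n t ht h1 (by linarith)

/-- The closure of the group generated by two real numbers. -/
noncomputable def pairGroup (a b : ℝ) : AddSubgroup ℝ :=
  (AddSubgroup.closure {a, b}).topologicalClosure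

theorem left_mem_pairGroup (a b : ℝ) : a ∈ pairGroup a b :=
  AddSubgroup.le_topologicalClosure _ (AddSubgroup.subset_closure (by simp))

theorem right_mem_pairGroup (a b : ℝ) : b ∈ pairGroup a b :=
  AddSubgroup.le_topologicalClosure _ (AddSubgroup.subset_closure (by simp))

/-- Far away from the origin, the semigroup generated by `a` and `b` is dense in the closure of the
group generated by them. -/
theorem exists_nat_combination_near {a b ε : ℝ} (ha : 0 < a) (hε : 0 < ε) :
    ∃ X : ℝ, ∀ y ∈ pairGroup a b, X ≤ y → ∃ j k : ℕ, |y - (j * a + k * b)| < ε := by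
  have hcl : IsClosed (pairGroup a b : Set ℝ) := AddSubgroup.isClosed_topologicalClosure _
  have hint : ∀ y ∈ pairGroup a b, ∃ j k : ℤ, |y - (j * a + k * b)| < ε / 2 := by
    intro y hy
    have hy' : y ∈ closure (AddSubgroup.closure {a, b} : Set ℝ) := hy
    obtain ⟨z, hz, hd⟩ := Metric.mem_closure_iff.1 hy' (ε / 2) (by positivity)
    obtain ⟨j, k, h⟩ := AddSubgroup.mem_closure_pair.1 hz
    exact ⟨j, k, by simpa [← h, Real.dist_eq] using hd⟩
  -- Finitely many group elements approximate all of the group in [0,a], so their integer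
  -- coefficients are bounded below by some -N. Subtracting Na + Nb and then multiples of a from y
  -- leaves a remainder in [0,a]; putting them back makes the coefficients nonnegative.
  obtain ⟨s, hs, hfin, hcov⟩ := ((isCompact_Icc (a := (0 : ℝ)) (b := a)).inter_right
    hcl).finite_cover_balls (e := ε / 2) (by positivity)
  choose! J K hJK using hint
  obtain ⟨N, hN⟩ : ∃ N : ℕ, ∀ x ∈ s, -(N : ℤ) ≤ J x ∧ -(N : ℤ) ≤ K x := by
    obtain ⟨N, hN⟩ := (hfin.image fun x => (J x).natAbs + (K x).natAbs).bddAbove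
    refine ⟨N, fun x hx => ?_⟩
    have := hN (Set.mem_image_of_mem _ hx)
    omega
  refine ⟨N * a + N * b, fun y hy hyX => ?_⟩
  set m := ⌊(y - (N * a + N * b)) / a⌋₊ with hm
  have hm1 : m * a ≤ y - (N * a + N * b) := by
    rw [← le_div_iff₀ ha]
    exact Nat.floor_le (div_nonneg (by linarith) ha.le)
  have hm2 : y - (N * a + N * b) ≤ (m + 1) * a := by
    rw [← div_le_iff₀ ha]
    exact (Nat.lt_floor_add_one _).le
  set r := y - (N * a + N * b) - m * a with hr
  have hrmem : r ∈ pairGroup a b := by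
    have h1 := left_mem_pairGroup a b
    have h2 := right_mem_pairGroup a b
    have h3 : ∀ (n : ℕ) (z : ℝ), z ∈ pairGroup a b → (n : ℝ) * z ∈ pairGroup a b := by
      intro n z hz
      rw [← nsmul_eq_mul]
      exact AddSubgroup.nsmul_mem _ hz n
    exact sub_mem (sub_mem hy (add_mem (h3 _ _ h1) (h3 _ _ h2))) (h3 _ _ h1)
  obtain ⟨x, hx, hxr⟩ : ∃ x ∈ s, r ∈ Metric.ball x (ε / 2) := by
    simpa using hcov ⟨⟨by linarith, by linarith⟩, hrmem⟩
  obtain ⟨hJ, hK⟩ := hN x hx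
  have hx' := hJK x (hs hx).2
  obtain ⟨j, hj⟩ := Int.eq_ofNat_of_zero_le (show 0 ≤ (N : ℤ) + m + J x by omega)
  obtain ⟨k, hk⟩ := Int.eq_ofNat_of_zero_le (show 0 ≤ (N : ℤ) + K x by omega)
  refine ⟨j, k, ?_⟩
  have hj' : (j : ℝ) = N + m + J x := by exact_mod_cast hj.symm
  have hk' : (k : ℝ) = N + K x := by exact_mod_cast hk.symm
  rw [Metric.mem_ball, Real.dist_eq] at hxr
  have : y - (j * a + k * b) = (r - x) + (x - (J x * a + K x * b)) := by
    rw [hj', hk', hr]; ring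
  rw [this]
  linarith [abs_add_le (r - x) (x - (J x * a + K x * b))]

/-- The points of the coset `t₀ + Γ`, where `Γ` is the closed group generated by `a` and `b`,
tending to infinity. -/
noncomputable def cosetAtTop (a b t₀ : ℝ) : Filter ℝ := atTop ⊓ 𝓟 {t | t - t₀ ∈ pairGroup a b}

theorem tendsto_sub_cosetAtTop {a b t₀ s : ℝ} (hs : s ∈ pairGroup a b) :
    Tendsto (fun t => t - s) (cosetAtTop a b t₀) (cosetAtTop a b t₀) := by
  refine tendsto_inf.2 ⟨(tendsto_atTop_add_const_right _ (-s) tendsto_id).mono_left inf_le_left,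
    tendsto_principal.2 ?_⟩
  refine Filter.Eventually.filter_mono inf_le_right (eventually_principal.2 fun t ht => ?_)
  have : t - s - t₀ = (t - t₀) - s := by ring
  simp only [Set.mem_ofPred_eq] at ht ⊢
  rw [this]
  exact sub_mem ht hs

theorem cosetAtTop_neBot {a b t₀ : ℝ} (ha : 0 < a) : (cosetAtTop a b t₀).NeBot := by
  refine inf_principal_neBot_iff.2 fun U hU => ?_
  obtain ⟨T, hT⟩ := mem_atTop_sets.1 hU
  obtain ⟨n, hn⟩ := exists_nat_ge ((T - t₀) / a)
  rw [div_le_iff₀ ha] at hn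
  refine ⟨t₀ + n * a, hT _ (by linarith), ?_⟩
  simp only [Set.mem_ofPred_eq, add_sub_cancel_left, ← nsmul_eq_mul]
  exact AddSubgroup.nsmul_mem _ (left_mem_pairGroup a b) n

section Renewal

variable {a b p : ℝ} {V : ℝ → ℝ}

/-- One backward step: if `V` is close to its limit superior at `w t`, it is so at `w t - a`. -/
theorem tendsto_backward_step {l l' : Filter ℝ} {M : ℝ} {w : ℝ → ℝ}
    (hp0 : 0 < p) (hp1 : p < 1) (ha : Tendsto (fun t => t - a) l l)
    (hb : Tendsto (fun t => t - b) l l)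
    (hr : Tendsto (fun t => V t - (p * V (t - a) + (1 - p) * V (t - b))) l (𝓝 0))
    (hM : ∀ y, M < y → ∀ᶠ t in l, V t < y) (hw : Tendsto w l' l)
    (hV : Tendsto (fun t => V (w t)) l' (𝓝 M)) :
    Tendsto (fun t => V (w t - a)) l' (𝓝 M) := by
  refine tendsto_order.2 ⟨fun y hy => ?_, fun y hy => (ha.comp hw).eventually (hM y hy)⟩
  -- With slack δ = p(M-y)/2, pV(w-a) > (M-δ) - (1-p)(M+δ) = pM - (2-p)δ > py.
  have hδ : 0 < p * (M - y) / 2 := by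
    have := sub_pos.2 hy
    positivity
  have h1 : Tendsto (fun t => V (w t) - (V (w t) - (p * V (w t - a) + (1 - p) * V (w t - b))))
      l' (𝓝 (M - 0)) := hV.sub (hr.comp hw)
  filter_upwards [h1.eventually (lt_mem_nhds (show M - p * (M - y) / 2 < M - 0 by linarith)),
    (hb.comp hw).eventually (hM (M + p * (M - y) / 2) (by linarith))] with t h2 h3
  simp only [Function.comp] at h3
  nlinarith

theorem tendsto_backward {l l' : Filter ℝ} {M : ℝ}
    (hp0 : 0 < p) (hp1 : p < 1) (ha : Tendsto (fun t => t - a) l l)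
    (hb : Tendsto (fun t => t - b) l l)
    (hr : Tendsto (fun t => V t - (p * V (t - a) + (1 - p) * V (t - b))) l (𝓝 0))
    (hM : ∀ y, M < y → ∀ᶠ t in l, V t < y) (hl : l' ≤ l)
    (hV : Tendsto V l' (𝓝 M)) (j k : ℕ) :
    Tendsto (fun t => t - (j * a + k * b)) l' l ∧
      Tendsto (fun t => V (t - (j * a + k * b))) l' (𝓝 M) := by
  -- Exchanging the two atoms lets the same backward step serve for shifts by b.
  have hr' : Tendsto (fun t => V t - ((1 - p) * V (t - b) + (1 - (1 - p)) * V (t - a))) l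
      (𝓝 0) := by
    convert hr using 2; ring
  induction j with
  | zero =>
    induction k with
    | zero => simpa using ⟨hl, hV⟩
    | succ k ih =>
      have e : ∀ t : ℝ, t - ((0 : ℕ) * a + (k + 1 : ℕ) * b) = t - ((0 : ℕ) * a + k * b) - b := by
        intro t; push_cast; ring
      simp only [e]
      exact ⟨hb.comp ih.1, tendsto_backward_step (by linarith) (by linarith) hb ha hr' hM ih.1 ih.2⟩
  | succ j ih =>
    have e : ∀ t : ℝ, t - ((j + 1 : ℕ) * a + k * b) = t - (j * a + k * b) - a := by
      intro t; push_cast; ring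
    simp only [e]
    exact ⟨ha.comp ih.1, tendsto_backward_step hp0 hp1 ha hb hr hM ih.1 ih.2⟩

/-- Renewal theorem: a bounded, uniformly continuous supersolution of the renewal equation whose
defect tends to zero converges at infinity along each coset of the closed group generated by the
two steps. -/
theorem exists_tendsto_cosetAtTop (ha : 0 < a) (hb : 0 < b) (hp0 : 0 < p) (hp1 : p < 1)
    (huc : UniformContinuous V) {C : ℝ} (hbdd : ∀ t, 0 ≤ t → |V t| ≤ C)
    (hsup : ∀ t, 0 ≤ t → p * V (t - a) + (1 - p) * V (t - b) ≤ V t)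
    (hr : Tendsto (fun t => V t - (p * V (t - a) + (1 - p) * V (t - b))) atTop (𝓝 0)) (t₀ : ℝ) :
    ∃ L, Tendsto V (cosetAtTop a b t₀) (𝓝 L) := by
  set l := cosetAtTop a b t₀ with hl
  have hne : l.NeBot := cosetAtTop_neBot ha
  have hltop : l ≤ atTop := inf_le_left
  have hla : Tendsto (fun t => t - a) l l := tendsto_sub_cosetAtTop (left_mem_pairGroup a b)
  have hlb : Tendsto (fun t => t - b) l l := tendsto_sub_cosetAtTop (right_mem_pairGroup a b)
  have hev : ∀ᶠ t in l, |V t| ≤ C :=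
    hltop ((eventually_ge_atTop 0).mono fun t ht => hbdd t ht)
  have hbd1 : IsBoundedUnder (· ≤ ·) l V :=
    isBoundedUnder_of_eventually_le (a := C) (hev.mono fun t ht => (abs_le.1 ht).2)
  have hbd2 : IsBoundedUnder (· ≥ ·) l V :=
    isBoundedUnder_of_eventually_ge (a := -C) (hev.mono fun t ht => (abs_le.1 ht).1)
  set M := limsup V l with hMdef
  have hM : ∀ y, M < y → ∀ᶠ t in l, V t < y := fun y hy => eventually_lt_of_limsup_lt hy hbd1
  have hM' : ∀ y, y < M → ∃ᶠ t in l, y < V t := fun y hy =>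
    frequently_lt_of_lt_limsup hbd2.isCoboundedUnder_le hy
  have hcl : MapClusterPt M l V := by
    rw [mapClusterPt_iff_frequently]
    intro s hs
    obtain ⟨ε, hε, hball⟩ := Metric.mem_nhds_iff.1 hs
    refine ((hM' (M - ε) (by linarith)).and_eventually (hM (M + ε) (by linarith))).mono ?_
    rintro t ⟨h1, h2⟩
    refine hball ?_
    rw [Metric.mem_ball, Real.dist_eq, abs_lt]
    constructor <;> linarith
  -- This filter plays the role of a subsequence along which V attains its limit superior.
  set l' := l ⊓ comap V (𝓝 M) with hl'
  have hne' : l'.NeBot := by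
    have h : (𝓝 M ⊓ map V l).NeBot := hcl
    rw [inf_comm, ← Filter.push_pull] at h
    exact h.of_map
  have hV : Tendsto V l' (𝓝 M) := tendsto_comap.mono_left inf_le_right
  have hback := tendsto_backward hp0 hp1 hla hlb (hr.mono_left hltop) hM inf_le_left hV
  refine ⟨M, tendsto_order.2 ⟨fun y hy => ?_, hM⟩⟩
  set ε := (M - y) / 3 with hε
  have hε0 : 0 < ε := by rw [hε]; linarith
  obtain ⟨δ, hδ, hucδ⟩ := Metric.uniformContinuous_iff.1 huc ε hε0
  obtain ⟨X, hX⟩ := exists_nat_combination_near (b := b) ha hδ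
  -- N bounds both coefficients of any ja + kb within δ of a point of [X, X + `max a b`]. Only
  -- finitely many translates are then needed, and a single t serves them all.
  obtain ⟨N, hN⟩ := exists_nat_gt ((X + max a b + δ) / min a b)
  have hmin : 0 < min a b := lt_min ha hb
  rw [div_lt_iff₀ hmin] at hN
  have h1 : ∀ᶠ t in l', ∀ j ∈ Finset.range N, ∀ k ∈ Finset.range N,
      M - ε < V (t - (j * a + k * b)) := by
    rw [Filter.eventually_all_finset]
    intro j _
    rw [Filter.eventually_all_finset]
    intro k _
    exact (hback j k).2.eventually (lt_mem_nhds (by linarith))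
  have h2 : ∀ᶠ t in l', X + max a b ≤ t - max a b :=
    (inf_le_left.trans hltop : l' ≤ atTop)
      ((eventually_ge_atTop (X + max a b + max a b)).mono fun t ht => by linarith)
  have h3 : ∀ᶠ t in l', t - t₀ ∈ pairGroup a b :=
    (inf_le_left.trans inf_le_right : l' ≤ 𝓟 {t | t - t₀ ∈ pairGroup a b}) (mem_principal_self _)
  obtain ⟨t, ht1, ht2, ht3⟩ := (h1.and (h2.and h3)).exists
  have hmax : 0 < max a b := lt_max_of_lt_left ha
  -- Each τ of the coset in this window is δ-close to some t - (ja + kb), where V > M - ε; uniform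
  -- continuity costs another ε. Since y = M - 3ε, forward propagation of this bound suffices.
  have hwin : ∀ τ ∈ {t | t - t₀ ∈ pairGroup a b}, t - X - max a b ≤ τ → τ ≤ t - X →
      M - 2 * ε ≤ V τ := by
    intro τ hτ hτ1 hτ2
    have hmem : t - τ ∈ pairGroup a b := by
      have := sub_mem ht3 hτ
      rwa [sub_sub_sub_cancel_right] at this
    obtain ⟨j, k, hjk⟩ := hX (t - τ) hmem (by linarith)
    have hjk' := abs_lt.1 hjk
    have hj0 : (0 : ℝ) ≤ j := Nat.cast_nonneg j
    have hk0 : (0 : ℝ) ≤ k := Nat.cast_nonneg k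
    have hja : (j : ℝ) * min a b ≤ j * a := by gcongr; exact min_le_left _ _
    have hkb : (k : ℝ) * min a b ≤ k * b := by gcongr; exact min_le_right _ _
    have hjm : 0 ≤ (j : ℝ) * min a b := by positivity
    have hkm : 0 ≤ (k : ℝ) * min a b := by positivity
    have hjN : j < N := by
      have : (j : ℝ) * min a b < N * min a b := by linarith
      exact_mod_cast lt_of_mul_lt_mul_right this hmin.le
    have hkN : k < N := by
      have : (k : ℝ) * min a b < N * min a b := by linarith
      exact_mod_cast lt_of_mul_lt_mul_right this hmin.le
    have h4 := ht1 j (Finset.mem_range.2 hjN) k (Finset.mem_range.2 hkN)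
    have h5 := @hucδ τ (t - (j * a + k * b)) (by
      rw [Real.dist_eq, abs_sub_comm]
      convert hjk using 2; ring)
    rw [Real.dist_eq] at h5
    have h6 := (abs_lt.1 h5).1
    linarith
  have hshift : ∀ s ∈ pairGroup a b, ∀ τ ∈ {t | t - t₀ ∈ pairGroup a b},
      τ - s ∈ {t | t - t₀ ∈ pairGroup a b} := by
    intro s hs τ hτ
    have : τ - s - t₀ = (τ - t₀) - s := by ring
    simp only [Set.mem_ofPred_eq] at hτ ⊢
    rw [this]
    exact sub_mem hτ hs
  have hfwd := renewal_forward ha hb hp0 hp1 (hshift a (left_mem_pairGroup a b))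
    (hshift b (right_mem_pairGroup a b)) (fun τ _ hτ => hsup τ (by linarith)) hwin
  have h4 : ∀ᶠ τ in l, τ ∈ {t | t - t₀ ∈ pairGroup a b} :=
    (inf_le_right : l ≤ 𝓟 {t | t - t₀ ∈ pairGroup a b}) (mem_principal_self _)
  filter_upwards [h4, hltop (eventually_ge_atTop (t - X - max a b))] with τ hτ hτ2
  have := hfwd τ hτ hτ2
  linarith

end Renewal

/-! ### The renewal equation for the Poissonized depth -/

/-- The deviation of the Poissonized depth from its main term, in the logarithmic scale. -/
noncomputable def depthError (p t : ℝ) : ℝ := poissonDepth p (Real.exp t) - t / letterEntropy p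

section DepthError

variable {p : ℝ}

theorem neg_log_pos (hp0 : 0 < p) (hp1 : p < 1) : 0 < -Real.log p :=
  neg_pos.2 (Real.log_neg hp0 hp1)

theorem neg_log_one_sub_pos (hp0 : 0 < p) (hp1 : p < 1) : 0 < -Real.log (1 - p) :=
  neg_pos.2 (Real.log_neg (by linarith) (by linarith))

theorem letterEntropy_pos (hp0 : 0 < p) (hp1 : p < 1) : 0 < letterEntropy p := by
  have h1 := mul_pos hp0 (neg_log_pos hp0 hp1)
  have h2 := mul_pos (sub_pos.2 hp1) (neg_log_one_sub_pos hp0 hp1)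
  unfold letterEntropy; linarith

theorem exp_sub_neg_log {x : ℝ} (hx : 0 < x) (t : ℝ) :
    Real.exp (t - -Real.log x) = x * Real.exp t := by
  rw [sub_neg_eq_add, Real.exp_add, Real.exp_log hx, mul_comm]

theorem poissonDepth_exp_eq (hp0 : 0 < p) (hp1 : p < 1) (t : ℝ) :
    poissonDepth p (Real.exp t) = (1 - Real.exp (-Real.exp t)) +
      (p * poissonDepth p (Real.exp (t - -Real.log p)) +
        (1 - p) * poissonDepth p (Real.exp (t - -Real.log (1 - p)))) := by
  rw [exp_sub_neg_log hp0, exp_sub_neg_log (sub_pos.2 hp1)]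
  exact poissonDepth_eq hp0 hp1 (Real.exp_pos t).le

/-- The drift t/H has renewal defect (pa + qb)/H = 1, which cancels the limit 1 of the Poisson
weight. -/
theorem depthError_eq (hp0 : 0 < p) (hp1 : p < 1) (t : ℝ) :
    depthError p t = p * depthError p (t - -Real.log p) +
      (1 - p) * depthError p (t - -Real.log (1 - p)) - Real.exp (-Real.exp t) := by
  have hH := (letterEntropy_pos hp0 hp1).ne'
  unfold depthError
  rw [poissonDepth_exp_eq hp0 hp1 t]
  have : p * ((t - -Real.log p) / letterEntropy p) +
      (1 - p) * ((t - -Real.log (1 - p)) / letterEntropy p) = t / letterEntropy p - 1 := by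
    field_simp
    unfold letterEntropy; ring
  linear_combination this

theorem uniformContinuous_depthError (hp0 : 0 < p) (hp1 : p < 1) :
    UniformContinuous (depthError p) := by
  have hH := letterEntropy_pos hp0 hp1
  have hq : 0 < 1 - p := by linarith
  set w : ℝ → ℝ := fun u => (Real.exp u - 1) / (p * (1 - p)) + u / letterEntropy p with hw
  have key : ∀ s t, s ≤ t → |depthError p t - depthError p s| ≤ w (t - s) := by
    intro s t hst
    obtain ⟨h1, h2⟩ := poissonDepth_mul_sub hp0 hp1 (Real.exp_pos s).le
      (Real.one_le_exp (sub_nonneg.2 hst))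
    rw [← Real.exp_add, sub_add_cancel] at h1 h2
    have h3 : 0 ≤ (t - s) / letterEntropy p := div_nonneg (by linarith) hH.le
    have h4 : depthError p t - depthError p s =
        (poissonDepth p (Real.exp t) - poissonDepth p (Real.exp s)) -
          (t - s) / letterEntropy p := by unfold depthError; ring
    rw [h4, abs_le]
    constructor <;> simp only [hw] <;> linarith
  have hwc : Tendsto w (𝓝 0) (𝓝 0) := by
    have : Continuous w := by fun_prop
    simpa [hw] using this.tendsto 0
  refine Metric.uniformContinuous_iff.2 fun ε hε => ?_
  obtain ⟨δ, hδ, h⟩ := Metric.tendsto_nhds_nhds.1 hwc ε hε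
  refine ⟨δ, hδ, fun {s t} hst => ?_⟩
  rw [Real.dist_eq] at hst ⊢
  rcases le_total s t with hle | hle
  · rw [abs_sub_comm] at hst ⊢
    have := h (x := t - s) (by simpa [Real.dist_eq] using hst)
    rw [Real.dist_eq, sub_zero] at this
    exact (key s t hle).trans_lt ((le_abs_self _).trans_lt this)
  · have := h (x := s - t) (by simpa [Real.dist_eq] using hst)
    rw [Real.dist_eq, sub_zero] at this
    exact (key t s hle).trans_lt ((le_abs_self _).trans_lt this)

/-- The negated error is a supersolution, which bounds the error from above. For the lower bound,
adding c·eᵗ/(1+eᵗ) with c = 1/(pq) compensates the term exp(-eᵗ) for t ≥ 0 and changes values by at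
most c. Both bounds start from compactness of a window ending at 0. -/
theorem exists_abs_depthError_le (hp0 : 0 < p) (hp1 : p < 1) :
    ∃ C, ∀ t, 0 ≤ t → |depthError p t| ≤ C := by
  have hq : 0 < 1 - p := by linarith
  have ha := neg_log_pos hp0 hp1
  have hb := neg_log_one_sub_pos hp0 hp1
  set a := -Real.log p with ha'
  set b := -Real.log (1 - p) with hb'
  obtain ⟨B, hB⟩ := (isCompact_Icc (a := 0 - max a b) (b := 0)).exists_bound_of_continuousOn
    (uniformContinuous_depthError hp0 hp1).continuous.continuousOn
  simp only [Real.norm_eq_abs] at hB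
  have hmax : 0 < max a b := lt_max_of_lt_left ha
  have hup := renewal_forward (V := fun t => -depthError p t) (m := -B) (T := 0) (D := Set.univ)
    ha hb hp0 hp1 (by simp) (by simp)
    (fun t _ _ => by
      have := depthError_eq hp0 hp1 t
      have := Real.exp_pos (-Real.exp t)
      linarith)
    (fun t _ h1 h2 => by linarith [(abs_le.1 (hB t ⟨h1, h2⟩)).2])
  set c := 1 / (p * (1 - p)) with hc
  have hc0 : 0 < c := by positivity
  set S : ℝ → ℝ := fun x => x / (1 + x) with hS
  have hS0 : ∀ t, 0 ≤ S (Real.exp t) := fun t => by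
    have := Real.exp_pos t
    simp only [hS]; positivity
  have hS1 : ∀ t, S (Real.exp t) ≤ 1 := fun t => by
    have := Real.exp_pos t
    simp only [hS]
    rw [div_le_one (by positivity)]; linarith
  have hlow := renewal_forward (V := fun t => depthError p t + c * S (Real.exp t)) (m := -B)
    (T := 0) (D := Set.univ) ha hb hp0 hp1 (by simp) (by simp)
    (fun t _ ht => by
      have h1 := depthError_eq hp0 hp1 t
      have h2 := logistic_sub_splitOp hp0 hp1 (Real.exp_pos t).le
      have h3 : splitOp p S (Real.exp t) =
          p * S (Real.exp (t - a)) + (1 - p) * S (Real.exp (t - b)) := by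
        rw [exp_sub_neg_log hp0, exp_sub_neg_log hq]; rfl
      change _ ≤ S (Real.exp t) - splitOp p S (Real.exp t) at h2
      rw [h3] at h2
      have h4 := mul_le_mul_of_nonneg_left h2 hc0.le
      have h5 : c * (2 * (p * (1 - p)) * (Real.exp t / (1 + Real.exp t) ^ 2)) =
          Real.exp t * (2 / (1 + Real.exp t) ^ 2) := by rw [hc]; field_simp
      have h6 := exp_neg_mul_le_logistic (Real.exp_pos t).le
      have h7 : 2 / (1 + Real.exp t) ^ 2 ≤ Real.exp t * (2 / (1 + Real.exp t) ^ 2) :=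
        le_mul_of_one_le_left (by positivity) (Real.one_le_exp ht)
      linarith)
    (fun t _ h1 h2 => by
      have := mul_nonneg hc0.le (hS0 t)
      linarith [(abs_le.1 (hB t ⟨h1, h2⟩)).1])
  refine ⟨B + c, fun t ht => abs_le.2 ⟨?_, ?_⟩⟩
  · have h1 := hlow t (Set.mem_univ _) (by linarith)
    have h2 := mul_le_mul_of_nonneg_left (hS1 t) hc0.le
    linarith
  · have h1 := hup t (Set.mem_univ _) (by linarith)
    linarith

theorem tendsto_exp_neg_exp : Tendsto (fun t => Real.exp (-Real.exp t)) atTop (𝓝 0) :=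
  Real.tendsto_exp_neg_atTop_nhds_zero.comp Real.tendsto_exp_atTop

theorem exists_tendsto_depthError (hp0 : 0 < p) (hp1 : p < 1) (t₀ : ℝ) :
    ∃ L, Tendsto (depthError p) (cosetAtTop (-Real.log p) (-Real.log (1 - p)) t₀) (𝓝 L) := by
  obtain ⟨C, hC⟩ := exists_abs_depthError_le hp0 hp1
  obtain ⟨L, hL⟩ := exists_tendsto_cosetAtTop (V := fun t => -depthError p t) (C := C)
    (neg_log_pos hp0 hp1) (neg_log_one_sub_pos hp0 hp1) hp0 hp1
    (uniformContinuous_depthError hp0 hp1).neg (fun t ht => by simpa using hC t ht)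
    (fun t _ => by
      have := depthError_eq hp0 hp1 t
      have := Real.exp_pos (-Real.exp t)
      linarith)
    (tendsto_exp_neg_exp.congr fun t => by
      have := depthError_eq hp0 hp1 t
      linarith) t₀
  exact ⟨-L, by simpa using hL.neg⟩

theorem exists_tendsto_depthError_of_irrational (hp0 : 0 < p) (hp1 : p < 1)
    (h : Irrational (Real.log p / Real.log (1 - p))) :
    ∃ L, Tendsto (depthError p) atTop (𝓝 L) := by
  obtain ⟨L, hL⟩ := exists_tendsto_depthError hp0 hp1 0
  refine ⟨L, ?_⟩
  have hd : Dense (AddSubgroup.closure {-Real.log p, -Real.log (1 - p)} : Set ℝ) :=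
    dense_addSubgroupClosure_pair_iff.2 (by rwa [neg_div_neg_eq])
  have e : {t : ℝ | t - 0 ∈ pairGroup (-Real.log p) (-Real.log (1 - p))} = Set.univ := by
    ext t
    refine iff_of_true ?_ (Set.mem_univ t)
    change t - 0 ∈ closure (AddSubgroup.closure {-Real.log p, -Real.log (1 - p)} : Set ℝ)
    rw [hd.closure_eq]
    exact Set.mem_univ _
  rwa [cosetAtTop, e, principal_univ, inf_top_eq] at hL

end DepthError

/-- A uniformly continuous function that converges along each arithmetic progression of step `d`
is asymptotic to a continuous `d`-periodic function. -/
theorem exists_periodic_of_tendsto_progression {K : ℝ → ℝ} (huc : UniformContinuous K) {d : ℝ}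
    (hd : 0 < d) (h : ∀ t, ∃ L, Tendsto (fun n : ℕ => K (t + n * d)) atTop (𝓝 L)) :
    ∃ κ : ℝ → ℝ, Continuous κ ∧ Function.Periodic κ d ∧
      Tendsto (fun t => K t - κ t) atTop (𝓝 0) := by
  choose κ hκ using h
  have hper : Function.Periodic κ d := by
    intro t
    refine tendsto_nhds_unique (hκ (t + d)) (((tendsto_add_atTop_iff_nat 1).2 (hκ t)).congr
      fun n => ?_)
    push_cast; ring_nf
  -- The limit inherits the modulus of continuity, so convergence at the finitely many points of a
  -- δ-net of [0,d] is enough.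
  have huκ : ∀ ε > 0, ∃ δ > 0, ∀ s t, |s - t| < δ → |K s - K t| < ε ∧ |κ s - κ t| ≤ ε := by
    intro ε hε
    obtain ⟨δ, hδ, hK⟩ := Metric.uniformContinuous_iff.1 huc ε hε
    refine ⟨δ, hδ, fun s t hst => ⟨hK hst, ?_⟩⟩
    refine le_of_tendsto ((hκ s).sub (hκ t)).abs (Eventually.of_forall fun n => ?_)
    exact (hK (show dist (s + n * d) (t + n * d) < δ by
      rw [Real.dist_eq]; simpa using hst)).le
  refine ⟨κ, ?_, hper, ?_⟩
  · refine (Metric.uniformContinuous_iff.2 fun ε hε => ?_).continuous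
    obtain ⟨δ, hδ, h⟩ := huκ (ε / 2) (by positivity)
    exact ⟨δ, hδ, fun {s t} hst => by
      rw [Real.dist_eq] at hst ⊢; linarith [(h s t hst).2]⟩
  · refine Metric.tendsto_atTop.2 fun ε hε => ?_
    obtain ⟨δ, hδ, hδ'⟩ := huκ (ε / 3) (by positivity)
    obtain ⟨s, -, hfin, hcov⟩ :=
      (isCompact_Icc (a := (0 : ℝ)) (b := d)).finite_cover_balls hδ
    have hev : ∀ᶠ n : ℕ in atTop, ∀ x ∈ s, |K (x + n * d) - κ x| < ε / 3 := by
      rw [Filter.eventually_all_finite hfin]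
      intro x _
      filter_upwards [Metric.tendsto_nhds.1 (hκ x) (ε / 3) (by positivity)] with n hn
      rwa [Real.dist_eq] at hn
    obtain ⟨N, hN⟩ := eventually_atTop.1 hev
    refine ⟨N * d, fun t ht => ?_⟩
    have hN0 : (N : ℝ) ≤ t / d := (le_div_iff₀ hd).2 ht
    have ht0 : 0 ≤ t / d := (Nat.cast_nonneg N).trans hN0
    set n := ⌊t / d⌋₊ with hn
    have hNn : N ≤ n := Nat.le_floor hN0
    have h1 : n * d ≤ t := (le_div_iff₀ hd).1 (Nat.floor_le ht0)
    have h2 : t ≤ (n + 1) * d := (div_le_iff₀ hd).1 (Nat.lt_floor_add_one _).le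
    obtain ⟨x, hx, hxb⟩ : ∃ x ∈ s, t - n * d ∈ Metric.ball x δ := by
      simpa using hcov (⟨by linarith, by linarith⟩ : t - n * d ∈ Set.Icc 0 d)
    rw [Metric.mem_ball, Real.dist_eq] at hxb
    have h3 := (hδ' t (x + n * d) (by convert hxb using 2; ring)).1
    have h4 := (hδ' (t - n * d) x hxb).2
    have h5 := hN n hNn x hx
    have h6 : κ (t - n * d) = κ t := hper.sub_nat_mul_eq n
    rw [h6] at h4
    rw [Real.dist_eq, sub_zero]
    rw [abs_lt] at h3 h5 ⊢
    rw [abs_le] at h4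
    constructor <;> linarith

theorem exists_periodic_depthError {p d : ℝ} (hp0 : 0 < p) (hp1 : p < 1) (hd : 0 < d)
    (hmem : d ∈ pairGroup (-Real.log p) (-Real.log (1 - p))) :
    ∃ κ : ℝ → ℝ, Continuous κ ∧ Function.Periodic κ d ∧
      Tendsto (fun t => depthError p t - κ t) atTop (𝓝 0) := by
  refine exists_periodic_of_tendsto_progression (uniformContinuous_depthError hp0 hp1) hd
    fun t => ?_
  obtain ⟨L, hL⟩ := exists_tendsto_depthError hp0 hp1 t
  refine ⟨L, hL.comp (tendsto_inf.2 ⟨?_, tendsto_principal.2 (Eventually.of_forall fun n => ?_)⟩)⟩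
  · exact tendsto_atTop_add_const_left _ _ (tendsto_natCast_atTop_atTop.atTop_mul_const hd)
  · simp only [Set.mem_ofPred_eq, add_sub_cancel_left, ← nsmul_eq_mul]
    exact AddSubgroup.nsmul_mem _ hmem n

/-! ### The Gamma integrals -/

/-- The density `t ↦ exp (t - exp t)`, the derivative of `t ↦ 1 - exp (-exp t)`. -/
noncomputable def gumbelDensity (t : ℝ) : ℝ := Real.exp t * Real.exp (-Real.exp t)

theorem hasDerivAt_one_sub_exp_neg_exp (t : ℝ) :
    HasDerivAt (fun t => 1 - Real.exp (-Real.exp t)) (gumbelDensity t) t := by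
  have := ((Real.hasDerivAt_exp t).fun_neg.exp).const_sub 1
  refine this.congr_deriv ?_
  unfold gumbelDensity; ring

theorem continuous_gumbelDensity : Continuous gumbelDensity := by
  unfold gumbelDensity; fun_prop

theorem exp_image_univ : Real.exp '' Set.univ = Set.Ioi 0 := by
  rw [Set.image_univ, Real.range_exp]

theorem integral_exp_smul_comp_exp (g : ℝ → ℂ) :
    ∫ t, Real.exp t • g (Real.exp t) = ∫ x in Set.Ioi 0, g x := by
  have := integral_image_eq_integral_abs_deriv_smul MeasurableSet.univ
    (fun x _ => (Real.hasDerivAt_exp x).hasDerivWithinAt)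
    (fun x _ y _ hxy => Real.exp_injective hxy) g
  rw [exp_image_univ] at this
  simpa [abs_of_pos (Real.exp_pos _)] using this.symm

theorem integrable_exp_smul_comp_exp (g : ℝ → ℂ) :
    Integrable (fun t => Real.exp t • g (Real.exp t)) ↔ IntegrableOn g (Set.Ioi 0) := by
  have := integrableOn_image_iff_integrableOn_abs_deriv_smul MeasurableSet.univ
    (fun x _ => (Real.hasDerivAt_exp x).hasDerivWithinAt)
    (fun x _ y _ hxy => Real.exp_injective hxy) g
  rw [exp_image_univ] at this
  simpa [abs_of_pos (Real.exp_pos _)] using this.symm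

theorem exp_ofReal_cpow (θ : ℂ) (t : ℝ) :
    ((Real.exp t : ℝ) : ℂ) ^ θ = Complex.exp (θ * t) := by
  rw [Complex.cpow_def_of_ne_zero (by exact_mod_cast (Real.exp_pos t).ne'),
    ← Complex.ofReal_log (Real.exp_pos t).le, Real.log_exp, mul_comm]

theorem integrable_exp_mul_gumbelDensity {θ : ℂ} (hθ : θ.re = 0) :
    Integrable fun t : ℝ => Complex.exp (θ * t) * gumbelDensity t := by
  have h := (integrable_exp_smul_comp_exp fun x => ((-x).exp : ℂ) * (x : ℂ) ^ (θ + 1 - 1)).2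
    (by simpa using Complex.GammaIntegral_convergent (s := θ + 1) (by simp [hθ]))
  refine h.congr (Eventually.of_forall fun t => ?_)
  simp only [add_sub_cancel_right, exp_ofReal_cpow, gumbelDensity, Complex.real_smul]
  push_cast; ring

theorem integral_exp_mul_gumbelDensity {θ : ℂ} (hθ : θ.re = 0) :
    ∫ t : ℝ, Complex.exp (θ * t) * gumbelDensity t = Complex.Gamma (θ + 1) := by
  rw [Complex.Gamma_eq_integral (by simp [hθ]), Complex.GammaIntegral,
    ← integral_exp_smul_comp_exp]
  congr 1 with t
  simp only [add_sub_cancel_right, exp_ofReal_cpow, gumbelDensity, Complex.real_smul]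
  push_cast; ring

/-- After x = eᵗ this is ∫ ln x · e^(-x) dx = Γ'(1). -/
theorem integral_ofReal_mul_gumbelDensity :
    ∫ t : ℝ, (t : ℂ) * gumbelDensity t = -Real.eulerMascheroniConstant := by
  have h1 := Complex.hasDerivAt_GammaIntegral (s := 1) (by simp)
  have h2 : Complex.GammaIntegral =ᶠ[𝓝 1] Complex.Gamma := by
    filter_upwards [(isOpen_lt continuous_const Complex.continuous_re).mem_nhds
      (show (0 : ℝ) < (1 : ℂ).re by simp)] with s hs
    exact (Complex.Gamma_eq_integral hs).symm
  have h3 := (h1.congr_of_eventuallyEq h2.symm).unique Complex.hasDerivAt_Gamma_one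
  rw [← h3, ← integral_exp_smul_comp_exp]
  congr 1 with t
  simp only [sub_self, Complex.cpow_zero, one_mul, Real.log_exp, gumbelDensity, Complex.real_smul]
  push_cast; ring

theorem integrable_ofReal_mul_gumbelDensity :
    Integrable fun t : ℝ => (t : ℂ) * gumbelDensity t := by
  -- The Bochner integral of a non-integrable function is 0, while here it is -γ ≠ 0.
  refine Integrable.of_integral_ne_zero ?_
  rw [integral_ofReal_mul_gumbelDensity]
  have := Real.one_half_lt_eulerMascheroniConstant
  have h : Real.eulerMascheroniConstant ≠ 0 := by linarith
  simpa using h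

/-! ### Moments of the limit over a period -/

section Moment

/-- The mean of the integrals of `f` over the windows `[t - a, t]` and `[t - b, t]`. -/
noncomputable def windowMean (p a b : ℝ) (f : ℝ → ℂ) (t : ℝ) : ℂ :=
  p * (∫ s in (t - a)..t, f s) + (1 - p) * ∫ s in (t - b)..t, f s

variable {p a b : ℝ}

theorem hasDerivAt_integral_window {f : ℝ → ℂ} (hf : Continuous f) (c t : ℝ) :
    HasDerivAt (fun t => ∫ s in (t - c)..t, f s) (f t - f (t - c)) t := by
  have h0 : ∀ x : ℝ, HasDerivAt (fun t => ∫ s in (0 : ℝ)..t, f s) (f x) x := fun x =>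
    (hf.integral_hasStrictDerivAt 0 x).hasDerivAt
  have h1 := (h0 t).sub ((h0 (t - c)).comp_sub_const t c)
  refine h1.congr_of_eventuallyEq (Eventually.of_forall fun x => ?_)
  exact (intervalIntegral.integral_interval_sub_left (hf.intervalIntegrable _ _)
    (hf.intervalIntegrable _ _)).symm

/-- Differentiation recovers the renewal operator, so averaging over windows integrates the renewal
equation. -/
theorem hasDerivAt_windowMean {f : ℝ → ℂ} (hf : Continuous f) (t : ℝ) :
    HasDerivAt (windowMean p a b f) (f t - (p * f (t - a) + (1 - p) * f (t - b))) t := by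
  have := ((hasDerivAt_integral_window hf a t).const_mul (p : ℂ)).add
    ((hasDerivAt_integral_window hf b t).const_mul (1 - p : ℂ))
  exact this.congr_deriv (by ring)

theorem norm_windowMean_le (hp0 : 0 < p) (hp1 : p < 1) (ha : 0 < a) (hb : 0 < b) {f : ℝ → ℂ}
    {C t : ℝ} (h : ∀ s ≤ t, t - max a b ≤ s → ‖f s‖ ≤ C) :
    ‖windowMean p a b f t‖ ≤ C * (p * a + (1 - p) * b) := by
  have h1 : ‖∫ s in (t - a)..t, f s‖ ≤ C * |t - (t - a)| :=
    intervalIntegral.norm_integral_le_of_norm_le_const fun s hs => by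
      rw [Set.uIoc_of_le (by linarith)] at hs
      exact h s hs.2 (by linarith [hs.1, le_max_left a b])
  have h2 : ‖∫ s in (t - b)..t, f s‖ ≤ C * |t - (t - b)| :=
    intervalIntegral.norm_integral_le_of_norm_le_const fun s hs => by
      rw [Set.uIoc_of_le (by linarith)] at hs
      exact h s hs.2 (by linarith [hs.1, le_max_right a b])
  rw [sub_sub_cancel, abs_of_pos ha] at h1
  rw [sub_sub_cancel, abs_of_pos hb] at h2
  have h3 : ‖(1 - p : ℂ)‖ = 1 - p := by
    rw [← Complex.ofReal_one, ← Complex.ofReal_sub, Complex.norm_of_nonneg (by linarith)]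
  have h4 : 0 < 1 - p := by linarith
  refine (norm_add_le _ _).trans ?_
  rw [norm_mul, norm_mul, h3, Complex.norm_of_nonneg hp0.le]
  calc p * ‖∫ s in (t - a)..t, f s‖ + (1 - p) * ‖∫ s in (t - b)..t, f s‖
      ≤ p * (C * a) + (1 - p) * (C * b) := by gcongr
    _ = _ := by ring

theorem windowMean_sub {f g : ℝ → ℂ} (hf : Continuous f) (hg : Continuous g) (t : ℝ) :
    windowMean p a b (fun s => f s - g s) t = windowMean p a b f t - windowMean p a b g t := by
  unfold windowMean
  rw [intervalIntegral.integral_sub (hf.intervalIntegrable _ _) (hg.intervalIntegrable _ _),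
    intervalIntegral.integral_sub (hf.intervalIntegrable _ _) (hg.intervalIntegrable _ _)]
  ring

theorem windowMean_const_mul (c : ℂ) (f : ℝ → ℂ) (t : ℝ) :
    windowMean p a b (fun s => c * f s) t = c * windowMean p a b f t := by
  unfold windowMean
  rw [intervalIntegral.integral_const_mul, intervalIntegral.integral_const_mul]
  ring

end Moment

/-- A continuous function on the line that is invariant under the two steps, with an antiderivative
of at most linear growth: the test functions for the moments of the periodic limit. -/
structure IsTestCharacter (a b : ℝ) (e E : ℝ → ℂ) : Prop where
  continuous : Continuous e
  norm_le : ∀ t, ‖e t‖ ≤ 1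
  sub_left : ∀ t, e (t - a) = e t
  sub_right : ∀ t, e (t - b) = e t
  hasDerivAt : ∀ t, HasDerivAt E (e t) t
  integrable : Integrable fun t : ℝ => E t * gumbelDensity t
  growth : ∃ A : ℝ, ∀ t, ‖E t‖ ≤ A * (1 + |t|)

section Character

variable {p : ℝ} {e E : ℝ → ℂ}

theorem continuous_poissonDepth_exp (hp0 : 0 < p) (hp1 : p < 1) :
    Continuous fun t => poissonDepth p (Real.exp t) := by
  have h1 := (uniformContinuous_depthError hp0 hp1).continuous
  have h2 : Continuous fun t : ℝ => depthError p t + t / letterEntropy p := by fun_prop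
  simpa [depthError] using h2

theorem tendsto_one_add_abs_mul_exp : Tendsto (fun t => (1 + |t|) * Real.exp t) atBot (𝓝 0) := by
  have h1 : Tendsto (fun t : ℝ => Real.exp (-t) + t * Real.exp (-t)) atTop (𝓝 (0 + 0)) :=
    Real.tendsto_exp_neg_atTop_nhds_zero.add
      (by simpa using Real.tendsto_pow_mul_exp_neg_atTop_nhds_zero 1)
  rw [add_zero] at h1
  refine (h1.comp tendsto_neg_atBot_atTop).congr' ?_
  filter_upwards [eventually_le_atBot 0] with t ht
  simp only [Function.comp, neg_neg, abs_of_nonpos ht]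
  ring

theorem tendsto_one_add_abs_mul_exp_neg_exp :
    Tendsto (fun t => (1 + |t|) * Real.exp (-Real.exp t)) atTop (𝓝 0) := by
  have h1 : Tendsto (fun t : ℝ => Real.exp t * Real.exp (-Real.exp t)) atTop (𝓝 0) := by
    have := (Real.tendsto_pow_mul_exp_neg_atTop_nhds_zero 1).comp Real.tendsto_exp_atTop
    simpa [Function.comp_def] using this
  refine squeeze_zero' (Eventually.of_forall fun t => by positivity) ?_ h1
  filter_upwards [eventually_ge_atTop 0] with t ht
  rw [abs_of_nonneg ht]
  gcongr
  linarith [Real.add_one_le_exp t]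

/-- The window mean has derivative (1 - exp(-eᵗ))e(t); removing E(t)(1 - exp(-eᵗ)) leaves the
integrable derivative -E(t) exp(t - eᵗ). The difference vanishes at -∞ because F(eᵗ) = O(eᵗ), so its
limit at +∞ is the full integral. -/
theorem tendsto_windowMean_poissonDepth (hp0 : 0 < p) (hp1 : p < 1)
    (he : IsTestCharacter (-Real.log p) (-Real.log (1 - p)) e E) :
    Tendsto (fun t => windowMean p (-Real.log p) (-Real.log (1 - p))
        (fun s => poissonDepth p (Real.exp s) * e s) t - E t * (1 - Real.exp (-Real.exp t) : ℝ))
      atTop (𝓝 (-∫ t : ℝ, E t * gumbelDensity t)) := by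
  have ha := neg_log_pos hp0 hp1
  have hb := neg_log_one_sub_pos hp0 hp1
  have hFc := continuous_poissonDepth_exp hp0 hp1
  have hcont : Continuous fun s => (poissonDepth p (Real.exp s) : ℂ) * e s := by
    have := he.continuous
    fun_prop
  set W := windowMean p (-Real.log p) (-Real.log (1 - p))
    (fun s => poissonDepth p (Real.exp s) * e s) with hW
  set Φ : ℝ → ℂ := fun t => W t - E t * (1 - Real.exp (-Real.exp t) : ℝ) with hΦ
  have hderiv : ∀ t, HasDerivAt Φ (-(E t * gumbelDensity t)) t := by
    intro t
    have h1 := (hasDerivAt_windowMean (p := p) (a := -Real.log p) (b := -Real.log (1 - p))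
      hcont t).sub ((he.hasDerivAt t).mul (hasDerivAt_one_sub_exp_neg_exp t).ofReal_comp)
    refine h1.congr_deriv ?_
    have h2 := congrArg (fun x : ℝ => (x : ℂ)) (poissonDepth_exp_eq hp0 hp1 t)
    simp only [he.sub_left, he.sub_right]
    push_cast at h2 ⊢
    rw [h2]
    ring
  have hgc : Continuous fun t => -(E t * gumbelDensity t) := by
    have h1 : Continuous E := continuous_iff_continuousAt.2 fun t => (he.hasDerivAt t).continuousAt
    have h2 := continuous_gumbelDensity
    fun_prop
  have hsub : ∀ t, Φ t = Φ (-t) + ∫ s in (-t)..t, -(E s * gumbelDensity s) := by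
    intro t
    rw [intervalIntegral.integral_eq_sub_of_hasDerivAt (fun s _ => hderiv s)
      (hgc.intervalIntegrable _ _)]
    ring
  have hbot : Tendsto Φ atBot (𝓝 0) := by
    set c := 1 / (1 - (p ^ 2 + (1 - p) ^ 2)) with hc
    have hc0 : 0 < c := by
      have := sq_add_sq_one_sub_lt_one hp0 hp1
      have : 0 < 1 - (p ^ 2 + (1 - p) ^ 2) := by linarith
      positivity
    have hW0 : Tendsto W atBot (𝓝 0) := by
      have h1 : Tendsto (fun t => c * Real.exp t *
          (p * -Real.log p + (1 - p) * -Real.log (1 - p))) atBot (𝓝 0) := by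
        simpa using (Real.tendsto_exp_atBot.const_mul c).mul_const
          (p * -Real.log p + (1 - p) * -Real.log (1 - p))
      refine squeeze_zero_norm (fun t => ?_) h1
      refine norm_windowMean_le hp0 hp1 ha hb fun s hs _ => ?_
      rw [norm_mul, Complex.norm_real, Real.norm_eq_abs]
      have h2 := abs_poissonDepth_le hp0 hp1 (Real.exp_pos s).le
      calc |poissonDepth p (Real.exp s)| * ‖e s‖ ≤ (c * Real.exp s) * 1 := by
            gcongr
            exact he.norm_le s
        _ ≤ c * Real.exp t := by rw [mul_one]; gcongr
    obtain ⟨A, hA⟩ := he.growth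
    have hE0 : Tendsto (fun t => E t * (1 - Real.exp (-Real.exp t) : ℝ)) atBot (𝓝 0) := by
      refine squeeze_zero_norm (fun t => ?_) (by
        simpa using tendsto_one_add_abs_mul_exp.const_mul A)
      rw [norm_mul, Complex.norm_real, Real.norm_eq_abs]
      have h2 := abs_poissonWeight_le (Real.exp_pos t).le
      rw [one_mul] at h2
      calc ‖E t‖ * |1 - Real.exp (-Real.exp t)| ≤ A * (1 + |t|) * Real.exp t :=
            mul_le_mul (hA t) h2 (abs_nonneg _) ((norm_nonneg _).trans (hA t))
        _ = _ := by ring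
    simpa only [sub_zero] using hW0.sub hE0
  have hint := intervalIntegral_tendsto_integral he.integrable.neg
    (tendsto_neg_atTop_atBot (G := ℝ)) tendsto_id
  have := (hbot.comp tendsto_neg_atTop_atBot).add hint
  rw [zero_add] at this
  simp only [Pi.neg_apply, integral_neg] at this
  exact this.congr fun t => (hsub t).symm

/-- Moments over a period of the function to which the deviation of the Poissonized depth is
asymptotic. -/
theorem windowMean_limit (hp0 : 0 < p) (hp1 : p < 1)
    (he : IsTestCharacter (-Real.log p) (-Real.log (1 - p)) e E) {c : ℂ}
    (hlin : ∀ t, windowMean p (-Real.log p) (-Real.log (1 - p)) (fun s => (s : ℂ) * e s) t =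
      letterEntropy p * (E t - c))
    {κ : ℝ → ℝ} (hκ : Continuous κ)
    (hκa : Function.Periodic κ (-Real.log p)) (hκb : Function.Periodic κ (-Real.log (1 - p)))
    (hlim : Tendsto (fun t => depthError p t - κ t) atTop (𝓝 0)) :
    windowMean p (-Real.log p) (-Real.log (1 - p)) (fun s => κ s * e s) 0 =
      c - ∫ t : ℝ, E t * gumbelDensity t := by
  have ha := neg_log_pos hp0 hp1
  have hb := neg_log_one_sub_pos hp0 hp1
  have hH := letterEntropy_pos hp0 hp1
  have hKc := (uniformContinuous_depthError hp0 hp1).continuous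
  have hFc := continuous_poissonDepth_exp hp0 hp1
  have hec := he.continuous
  set a := -Real.log p with ha'
  set b := -Real.log (1 - p) with hb'
  have hF := tendsto_windowMean_poissonDepth hp0 hp1 he
  have hcF : Continuous fun s => (poissonDepth p (Real.exp s) : ℂ) * e s := by fun_prop
  have hclin : Continuous fun s : ℝ => ((letterEntropy p : ℂ)⁻¹) * ((s : ℂ) * e s) := by fun_prop
  have hcK : Continuous fun s => (depthError p s : ℂ) * e s := by fun_prop
  have hcκ : Continuous fun s => (κ s : ℂ) * e s := by fun_prop
  have hK : ∀ t, windowMean p a b (fun s => (depthError p s : ℂ) * e s) t =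
      windowMean p a b (fun s => (poissonDepth p (Real.exp s) : ℂ) * e s) t - (E t - c) := by
    intro t
    have h1 : (fun s => (depthError p s : ℂ) * e s) = fun s =>
        (poissonDepth p (Real.exp s) : ℂ) * e s - (letterEntropy p : ℂ)⁻¹ * ((s : ℂ) * e s) := by
      funext s
      unfold depthError
      push_cast
      ring
    rw [h1, windowMean_sub hcF hclin, windowMean_const_mul, hlin, inv_mul_cancel_left₀]
    exact_mod_cast hH.ne'
  obtain ⟨A, hA⟩ := he.growth
  have hE0 : Tendsto (fun t => E t * (Real.exp (-Real.exp t) : ℝ)) atTop (𝓝 0) := by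
    refine squeeze_zero_norm (fun t => ?_) (by
      simpa using tendsto_one_add_abs_mul_exp_neg_exp.const_mul A)
    rw [norm_mul, Complex.norm_real, Real.norm_eq_abs, abs_of_pos (Real.exp_pos _)]
    calc ‖E t‖ * Real.exp (-Real.exp t) ≤ A * (1 + |t|) * Real.exp (-Real.exp t) := by
          gcongr; exact hA t
      _ = _ := by ring
  have hK1 : Tendsto (fun t => windowMean p a b (fun s => (depthError p s : ℂ) * e s) t) atTop
      (𝓝 (c - ∫ t : ℝ, E t * gumbelDensity t)) := by
    have := (hF.sub hE0).add_const c
    rw [sub_zero, neg_add_eq_sub] at this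
    refine this.congr fun t => ?_
    rw [hK]
    push_cast; ring
  -- Both window lengths are periods of κ·e, so its window mean is constant and equals the limit
  -- computed for the error.
  have hper : ∀ t, windowMean p a b (fun s => (κ s : ℂ) * e s) t =
      windowMean p a b (fun s => (κ s : ℂ) * e s) 0 := by
    have key : ∀ c : ℝ, Function.Periodic κ c → (∀ t, e (t - c) = e t) → ∀ t,
        ∫ s in (t - c)..t, (κ s : ℂ) * e s = ∫ s in (0 - c)..0, (κ s : ℂ) * e s := by
      intro c h1 h2 t
      have h3 : Function.Periodic (fun s => (κ s : ℂ) * e s) c := by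
        intro s
        have := h2 (s + c)
        rw [add_sub_cancel_right] at this
        simp only [h1 s, this]
      simpa using h3.intervalIntegral_add_eq (t - c) (0 - c)
    intro t
    unfold windowMean
    rw [key a hκa he.sub_left, key b hκb he.sub_right]
  have hdiff : Tendsto (fun t => windowMean p a b (fun s => (depthError p s : ℂ) * e s) t -
      windowMean p a b (fun s => (κ s : ℂ) * e s) t) atTop (𝓝 0) := by
    have h0 : 0 < p * a + (1 - p) * b := by
      have : 0 < 1 - p := by linarith
      positivity
    refine Metric.tendsto_atTop.2 fun ε hε => ?_
    obtain ⟨T, hT⟩ := Metric.tendsto_atTop.1 hlim (ε / (2 * (p * a + (1 - p) * b)))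
      (by positivity)
    refine ⟨T + max a b, fun t ht => ?_⟩
    rw [← windowMean_sub hcK hcκ, dist_zero_right]
    refine (norm_windowMean_le hp0 hp1 ha hb (C := ε / (2 * (p * a + (1 - p) * b)))
      fun s _ hs => ?_).trans_lt ?_
    · have h1 := hT s (by linarith)
      rw [Real.dist_eq, sub_zero] at h1
      rw [← sub_mul, norm_mul, ← Complex.ofReal_sub, Complex.norm_real, Real.norm_eq_abs]
      calc |depthError p s - κ s| * ‖e s‖ ≤ |depthError p s - κ s| * 1 := by
            gcongr; exact he.norm_le s
        _ ≤ _ := by rw [mul_one]; exact h1.le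
    · have : ε / (2 * (p * a + (1 - p) * b)) * (p * a + (1 - p) * b) = ε / 2 := by field_simp
      rw [this]; linarith
  have h1 := hK1.sub hdiff
  simp only [sub_sub_cancel, hper, sub_zero] at h1
  exact tendsto_nhds_unique tendsto_const_nhds h1

end Character

section Moments

variable {p : ℝ} {κ : ℝ → ℝ}

/-- The mean of the periodic limit. -/
theorem integral_limit (hp0 : 0 < p) (hp1 : p < 1) (hκ : Continuous κ)
    (hκa : Function.Periodic κ (-Real.log p)) (hκb : Function.Periodic κ (-Real.log (1 - p)))
    (hlim : Tendsto (fun t => depthError p t - κ t) atTop (𝓝 0)) :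
    windowMean p (-Real.log p) (-Real.log (1 - p)) (fun s => (κ s : ℂ)) 0 =
      letterSecondMoment p / (2 * letterEntropy p) + Real.eulerMascheroniConstant := by
  have hH := letterEntropy_pos hp0 hp1
  have hH' : (letterEntropy p : ℂ) ≠ 0 := by exact_mod_cast hH.ne'
  have he : IsTestCharacter (-Real.log p) (-Real.log (1 - p)) (fun _ => 1)
      (fun t : ℝ => (t : ℂ)) := by
    refine ⟨continuous_const, by simp, by simp, by simp, fun t => ?_,
      integrable_ofReal_mul_gumbelDensity, 1, fun t => ?_⟩
    · simpa using (hasDerivAt_id t).ofReal_comp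
    · simp
  -- The window mean of s is Ht - H₂/2 = H(t - H₂/(2H)), whence this c.
  have h := windowMean_limit hp0 hp1 he (c := letterSecondMoment p / (2 * letterEntropy p))
    (fun t => ?_) hκ hκa hκb hlim
  · simpa [integral_ofReal_mul_gumbelDensity] using h
  · simp only [mul_one, windowMean]
    have hint : ∀ x y : ℝ, ∫ s in x..y, (s : ℂ) = ((y ^ 2 - x ^ 2) / 2 : ℝ) := by
      intro x y
      rw [intervalIntegral.integral_ofReal, integral_id]
    rw [hint, hint]
    have : p * ((t ^ 2 - (t - -Real.log p) ^ 2) / 2) +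
        (1 - p) * ((t ^ 2 - (t - -Real.log (1 - p)) ^ 2) / 2) =
        letterEntropy p * t - letterSecondMoment p / 2 := by
      unfold letterEntropy letterSecondMoment; ring
    have h2 := congrArg (fun x : ℝ => (x : ℂ)) this
    push_cast at h2 ⊢
    rw [h2]
    field_simp

/-- The Fourier integrals of the periodic limit. -/
theorem integral_exp_mul_limit (hp0 : 0 < p) (hp1 : p < 1) (hκ : Continuous κ)
    (hκa : Function.Periodic κ (-Real.log p)) (hκb : Function.Periodic κ (-Real.log (1 - p)))
    (hlim : Tendsto (fun t => depthError p t - κ t) atTop (𝓝 0)) {θ : ℂ} (hθ : θ ≠ 0)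
    (hre : θ.re = 0) (hθa : Complex.exp (θ * (-Real.log p : ℝ)) = 1)
    (hθb : Complex.exp (θ * (-Real.log (1 - p) : ℝ)) = 1) :
    windowMean p (-Real.log p) (-Real.log (1 - p)) (fun s => κ s * Complex.exp (θ * s)) 0 =
      -Complex.Gamma θ := by
  have hnorm : ∀ t : ℝ, ‖Complex.exp (θ * t)‖ = 1 := by
    intro t
    rw [Complex.norm_exp]
    simp [hre]
  have hshift : ∀ c : ℝ, Complex.exp (θ * c) = 1 → ∀ t : ℝ,
      Complex.exp (θ * (t - c : ℝ)) = Complex.exp (θ * t) := by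
    intro c hc t
    push_cast
    rw [mul_sub, Complex.exp_sub, hc, div_one]
  have hdE : ∀ t : ℝ, HasDerivAt (fun t : ℝ => Complex.exp (θ * t) / θ) (Complex.exp (θ * t)) t := by
    intro t
    have h1 : HasDerivAt (fun t : ℝ => θ * (t : ℂ)) θ t := by
      simpa using ((hasDerivAt_id t).ofReal_comp).const_mul θ
    simpa [hθ] using h1.cexp.div_const θ
  have he : IsTestCharacter (-Real.log p) (-Real.log (1 - p)) (fun t => Complex.exp (θ * t))
      (fun t : ℝ => Complex.exp (θ * t) / θ) := by
    refine ⟨by fun_prop, fun t => (hnorm t).le, hshift _ hθa, hshift _ hθb, hdE, ?_, ‖θ‖⁻¹,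
      fun t => ?_⟩
    · simpa [div_mul_eq_mul_div] using (integrable_exp_mul_gumbelDensity hre).div_const θ
    · rw [norm_div, hnorm, one_div]
      exact le_mul_of_one_le_right (by positivity) (by linarith [abs_nonneg t])
  have h := windowMean_limit hp0 hp1 he (c := 0) (fun t => ?_) hκ hκa hκb hlim
  · rw [h]
    simp only [div_mul_eq_mul_div]
    rw [integral_div, integral_exp_mul_gumbelDensity hre, Complex.Gamma_add_one θ hθ,
      mul_div_cancel_left₀ _ hθ, zero_sub]
  -- In the antiderivative s·e^(θs)/θ - e^(θs)/θ² the second term is c-periodic and drops out; hence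
  -- the offset in the linear part is 0.
  · have key : ∀ c : ℝ, Complex.exp (θ * c) = 1 →
        ∫ s in (t - c)..t, (s : ℂ) * Complex.exp (θ * s) = c * (Complex.exp (θ * t) / θ) := by
      intro c hc
      have hd : ∀ s : ℝ, HasDerivAt (fun s : ℝ => (s : ℂ) * (Complex.exp (θ * s) / θ) -
          Complex.exp (θ * s) / θ / θ) ((s : ℂ) * Complex.exp (θ * s)) s := by
        intro s
        have h1 : HasDerivAt (fun s : ℝ => (s : ℂ)) 1 s := by
          simpa using (hasDerivAt_id s).ofReal_comp
        refine ((h1.mul (hdE s)).sub ((hdE s).div_const θ)).congr_deriv ?_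
        ring
      rw [intervalIntegral.integral_eq_sub_of_hasDerivAt (fun s _ => hd s)
        (Continuous.intervalIntegrable (by fun_prop) _ _), hshift c hc]
      push_cast; ring
    unfold windowMean
    rw [key _ hθa, key _ hθb]
    unfold letterEntropy
    push_cast; ring

end Moments

/-! ### The Fourier series of the periodic limit -/

theorem norm_Gamma_le {s : ℂ} (hs : 0 < s.re) : ‖Complex.Gamma s‖ ≤ Real.Gamma s.re := by
  rw [Complex.Gamma_eq_integral hs, Complex.GammaIntegral, Real.Gamma_eq_integral hs]
  refine (norm_integral_le_integral_norm _).trans (le_of_eq ?_)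
  refine setIntegral_congr_fun measurableSet_Ioi fun x hx => ?_
  rw [norm_mul, Complex.norm_of_nonneg (Real.exp_pos _).le,
    Complex.norm_cpow_eq_rpow_re_of_pos hx]
  simp

/-- From Γ(θ+2) = (θ+1)θΓ(θ), |Γ(θ+2)| ≤ Γ(2) = 1 and |θ| ≤ |θ+1|. Quadratic decay is all that
summability of the Fourier coefficients requires. -/
theorem norm_Gamma_le_of_re_eq_zero {θ : ℂ} (hθ : θ ≠ 0) (hre : θ.re = 0) :
    ‖Complex.Gamma θ‖ ≤ 1 / ‖θ‖ ^ 2 := by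
  have hθ1 : θ + 1 ≠ 0 := by
    intro h
    have := congrArg Complex.re h
    simp [hre] at this
  have h1 : Complex.Gamma (θ + 1 + 1) = (θ + 1) * (θ * Complex.Gamma θ) := by
    rw [Complex.Gamma_add_one _ hθ1, Complex.Gamma_add_one _ hθ]
  have h2 : ‖Complex.Gamma (θ + 1 + 1)‖ ≤ 1 := by
    refine (norm_Gamma_le (by simp [hre])).trans (le_of_eq ?_)
    have : (θ + 1 + 1).re = 2 := by simp [hre]; norm_num
    rw [this, Real.Gamma_two]
  have h3 : ‖θ‖ ≤ ‖θ + 1‖ := by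
    refine Real.sqrt_le_sqrt ?_
    simp [Complex.normSq_apply, hre]
  have h4 : 0 < ‖θ‖ := norm_pos_iff.2 hθ
  rw [h1, norm_mul, norm_mul] at h2
  rw [le_div_iff₀ (by positivity)]
  calc ‖Complex.Gamma θ‖ * ‖θ‖ ^ 2 = ‖θ‖ * (‖θ‖ * ‖Complex.Gamma θ‖) := by ring
    _ ≤ ‖θ + 1‖ * (‖θ‖ * ‖Complex.Gamma θ‖) := by gcongr
    _ ≤ 1 := h2

theorem windowMean_of_periodic {p d : ℝ} {f : ℝ → ℂ} (hf : Continuous f)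
    (hper : Function.Periodic f d) (n m : ℕ) :
    windowMean p (n * d) (m * d) f 0 = (p * n + (1 - p) * m) * ∫ s in (0 : ℝ)..d, f s := by
  have key : ∀ n : ℕ, ∫ s in (0 - n * d)..0, f s = n * ∫ s in (0 : ℝ)..d, f s := by
    intro n
    have h1 : Function.Periodic f (n * d) := hper.nat_mul n
    have h2 := h1.intervalIntegral_add_eq (0 - n * d) 0
    rw [sub_add_cancel, zero_add] at h2
    have h3 := hper.intervalIntegral_add_zsmul_eq n 0 (fun _ _ => hf.intervalIntegrable _ _)
    simp only [zero_add, zsmul_eq_mul, Int.cast_natCast] at h3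
    rw [h2, h3]
  unfold windowMean
  rw [key, key]
  ring

section FourierSeries

variable {p d : ℝ} {κ : ℝ → ℝ}

/-- Since H = (pn + qm)d, a window mean of a d-periodic function is H times its mean over one
period, so the moments are H times the Fourier coefficients of κ. These are summable and κ is
continuous, so the series represents κ pointwise; the coefficient at 0 is the constant subtracted
from κ. -/
theorem hasSum_periodic_limit (hp0 : 0 < p) (hp1 : p < 1) (hd : 0 < d) {n m : ℕ}
    (hn : -Real.log p = n * d) (hm : -Real.log (1 - p) = m * d)
    (hκ : Continuous κ) (hper : Function.Periodic κ d)
    (hlim : Tendsto (fun t => depthError p t - κ t) atTop (𝓝 0)) (t : ℝ) :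
    HasSum (fun k : {k : ℤ // k ≠ 0} => -(1 / (letterEntropy p : ℂ)) *
        (Complex.Gamma (-2 * Real.pi * Complex.I * (k : ℤ) / d) *
          Complex.exp (2 * Real.pi * Complex.I * (k : ℤ) * t / d)))
      ((κ t - (letterSecondMoment p / (2 * letterEntropy p ^ 2) +
        Real.eulerMascheroniConstant / letterEntropy p) : ℝ) : ℂ) := by
  have hH := letterEntropy_pos hp0 hp1
  have hH' : (letterEntropy p : ℂ) ≠ 0 := by exact_mod_cast hH.ne'
  have hd' : (d : ℂ) ≠ 0 := by exact_mod_cast hd.ne'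
  have hdfact : Fact (0 < d) := ⟨hd⟩
  have hκa : Function.Periodic κ (-Real.log p) := hn ▸ hper.nat_mul n
  have hκb : Function.Periodic κ (-Real.log (1 - p)) := hm ▸ hper.nat_mul m
  have hHd : letterEntropy p = (p * n + (1 - p) * m) * d := by
    unfold letterEntropy
    linear_combination p * hn + (1 - p) * hm
  have hHd' : (letterEntropy p : ℂ) = (p * n + (1 - p) * m) * d := by exact_mod_cast hHd
  have hperC : Function.Periodic (fun s => (κ s : ℂ)) d := fun s => by simp only [hper s]
  have hκC : Continuous fun s => (κ s : ℂ) := by fun_prop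
  have hliftc : Continuous hperC.lift :=
    hκC.quotient_lift _
  set f : C(AddCircle d, ℂ) := ⟨hperC.lift, hliftc⟩ with hf
  have hfc : ∀ s : ℝ, f s = κ s := fun s => hperC.lift_coe s
  set θ : ℤ → ℂ := fun k => -2 * Real.pi * Complex.I * k / d with hθ
  have hθre : ∀ k, (θ k).re = 0 := by
    intro k
    have : θ k = ((-2 * Real.pi * k / d : ℝ) : ℂ) * Complex.I := by
      simp only [hθ]; push_cast; ring
    rw [this, Complex.re_ofReal_mul, Complex.I_re, mul_zero]
  have hθ0 : ∀ k, k ≠ 0 → θ k ≠ 0 := by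
    intro k hk
    simp only [hθ]
    have : (k : ℂ) ≠ 0 := by exact_mod_cast hk
    simp [hd', this, Real.pi_ne_zero]
  have hθd : ∀ (k : ℤ) (j : ℕ), Complex.exp (θ k * ((j : ℝ) * d : ℝ)) = 1 := by
    intro k j
    rw [Complex.exp_eq_one_iff]
    refine ⟨-k * j, ?_⟩
    simp only [hθ]; push_cast; field_simp
  have hcoef : ∀ k, fourierCoeff f k = (letterEntropy p : ℂ)⁻¹ *
      windowMean p (-Real.log p) (-Real.log (1 - p)) (fun s => κ s * Complex.exp (θ k * s)) 0 := by
    intro k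
    have hper' : Function.Periodic (fun s : ℝ => κ s * Complex.exp (θ k * s)) d := by
      intro s
      have h1 := hθd k 1
      rw [Nat.cast_one, one_mul] at h1
      simp only [hper s]
      push_cast
      rw [mul_add, Complex.exp_add, h1, mul_one]
    have hc : Continuous fun s : ℝ => (κ s : ℂ) * Complex.exp (θ k * s) := by fun_prop
    rw [hn, hm, windowMean_of_periodic hc hper', fourierCoeff_eq_intervalIntegral f k 0, zero_add,
      Complex.real_smul]
    have hi : ∫ s in (0 : ℝ)..d, fourier (-k) (s : AddCircle d) • f s =
        ∫ s in (0 : ℝ)..d, (κ s : ℂ) * Complex.exp (θ k * s) := by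
      refine intervalIntegral.integral_congr fun s _ => ?_
      simp only [fourier_coe_apply, hfc, smul_eq_mul, hθ]
      rw [mul_comm]
      congr 2
      push_cast; ring
    rw [hi, hHd']
    have hne : ((p : ℂ) * n + (1 - p) * m) ≠ 0 := left_ne_zero_of_mul (hHd' ▸ hH')
    push_cast
    field_simp
  have hcoef0 : fourierCoeff f 0 = (letterSecondMoment p / (2 * letterEntropy p ^ 2) +
        Real.eulerMascheroniConstant / letterEntropy p : ℝ) := by
    have h1 : (fun s : ℝ => (κ s : ℂ) * Complex.exp (θ 0 * s)) = fun s => (κ s : ℂ) := by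
      funext s; simp [hθ]
    rw [hcoef, h1, integral_limit hp0 hp1 hκ hκa hκb hlim]
    push_cast
    field_simp
  have hcoefk : ∀ k, k ≠ 0 →
      fourierCoeff f k = -(1 / (letterEntropy p : ℂ)) * Complex.Gamma (θ k) := by
    intro k hk
    rw [hcoef, integral_exp_mul_limit hp0 hp1 hκ hκa hκb hlim (hθ0 k hk) (hθre k)
      (hn ▸ hθd k n) (hm ▸ hθd k m)]
    ring
  have hsum : Summable (fourierCoeff f) := by
    have hs : Summable fun k : ℤ =>
        (1 / letterEntropy p * (d / (2 * Real.pi)) ^ 2) * (1 / (k : ℝ) ^ 2) :=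
      (Real.summable_one_div_int_pow.2 one_lt_two).mul_left _
    refine hs.of_norm_bounded_eventually ?_
    refine (Set.finite_singleton (0 : ℤ)).subset fun k hk => ?_
    by_contra hk0
    refine hk ?_
    have hk0' : k ≠ 0 := hk0
    have h1 := norm_Gamma_le_of_re_eq_zero (hθ0 k hk0') (hθre k)
    have h2 : ‖θ k‖ = 2 * Real.pi * |(k : ℝ)| / d := by
      simp only [hθ, norm_div, norm_mul, norm_neg, Complex.norm_I, Complex.norm_real,
        Complex.norm_intCast, Real.norm_eq_abs, abs_of_pos Real.pi_pos, abs_of_pos hd]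
      simp
    have hkabs : (k : ℝ) ≠ 0 := by exact_mod_cast hk0'
    change ‖fourierCoeff f k‖ ≤ _
    rw [hcoefk k hk0', norm_mul, norm_neg, norm_div, norm_one, Complex.norm_of_nonneg hH.le]
    calc 1 / letterEntropy p * ‖Complex.Gamma (θ k)‖
        ≤ 1 / letterEntropy p * (1 / ‖θ k‖ ^ 2) := by gcongr
      _ = _ := by
        rw [h2, div_pow, mul_pow, sq_abs, div_pow]
        field_simp
  have h := hasSum_ite_sub_hasSum (has_pointwise_sum_fourier_series_of_summable hsum t) 0
  rw [hcoef0, hfc, fourier_zero, smul_eq_mul, mul_one, ← Complex.ofReal_sub] at h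
  refine (hasSum_subtype_iff_indicator (s := {k : ℤ | k ≠ 0})
    (f := fun k : ℤ => -(1 / (letterEntropy p : ℂ)) *
      (Complex.Gamma (-2 * Real.pi * Complex.I * k / d) *
        Complex.exp (2 * Real.pi * Complex.I * k * t / d)))).2 ?_
  convert! h using 2 with k
  by_cases hk : k = 0
  · simp [hk]
  · rw [Set.indicator_of_mem (show k ∈ {k : ℤ | k ≠ 0} from hk), if_neg hk, hcoefk k hk,
      fourier_coe_apply, smul_eq_mul]
    exact (mul_assoc _ _ _).symm

end FourierSeries

/-! ### The two cases -/

section Cases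

variable {p : ℝ}

/-- The limit exists by the renewal theorem; seen as a constant κ, it is determined by its mean
alone. -/
theorem tendsto_depthError_of_irrational (hp0 : 0 < p) (hp1 : p < 1)
    (h : Irrational (Real.log p / Real.log (1 - p))) :
    Tendsto (depthError p) atTop (𝓝 (letterSecondMoment p / (2 * letterEntropy p ^ 2) +
      Real.eulerMascheroniConstant / letterEntropy p)) := by
  obtain ⟨L, hL⟩ := exists_tendsto_depthError_of_irrational hp0 hp1 h
  have hH := letterEntropy_pos hp0 hp1
  have h1 := integral_limit hp0 hp1 (κ := fun _ => L) continuous_const (fun _ => rfl)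
    (fun _ => rfl) (by simpa using hL.sub_const L)
  have h2 : windowMean p (-Real.log p) (-Real.log (1 - p)) (fun _ => (L : ℂ)) 0 =
      (letterEntropy p * L : ℝ) := by
    simp only [windowMean, intervalIntegral.integral_const, letterEntropy, Complex.real_smul]
    push_cast; ring
  rw [h2] at h1
  have h3 : letterEntropy p * L =
      letterSecondMoment p / (2 * letterEntropy p) + Real.eulerMascheroniConstant := by
    exact_mod_cast h1
  have h4 : L = letterSecondMoment p / (2 * letterEntropy p ^ 2) +
      Real.eulerMascheroniConstant / letterEntropy p := by
    refine mul_left_cancel₀ hH.ne' (h3.trans ?_)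
    field_simp
  rwa [← h4]

/-- Two positive real numbers with a rational ratio are coprime multiples of a real number. -/
theorem exists_common_divisor {a b : ℝ} (ha : 0 < a) (hb : 0 < b) {r : ℚ} (hr : a / b = r) :
    ∃ d : ℝ, 0 < d ∧ d ∈ pairGroup a b ∧ (∃ n m : ℕ, a = n * d ∧ b = m * d) ∧
      ∀ e : ℝ, 0 < e → (∃ x : ℤ, a = x * e) → (∃ y : ℤ, b = y * e) → e ≤ d := by
  have hr0 : 0 < r := by
    have : (0 : ℝ) < r := hr ▸ div_pos ha hb
    exact_mod_cast this
  have hden : (0 : ℝ) < r.den := by exact_mod_cast r.den_pos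
  obtain ⟨n, hn⟩ := Int.eq_ofNat_of_zero_le (Rat.num_pos.2 hr0).le
  have hrn : (r : ℝ) = n / r.den := by
    rw [Rat.cast_def, hn, Int.cast_natCast]
  have hbd : b = r.den * (b / r.den) := by field_simp
  have had : a = n * (b / r.den) := by
    rw [div_eq_iff hb.ne', hrn] at hr
    rw [hr]; ring
  refine ⟨b / r.den, div_pos hb hden, ?_, ⟨n, r.den, had, hbd⟩, ?_⟩
  -- Bézout for the reduced fraction n/m = a/b exhibits d = b/m as an integer combination of a and
  -- b.
  · have hcop : IsCoprime r.num (r.den : ℤ) := Rat.isCoprime_num_den r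
    obtain ⟨u, v, huv⟩ := hcop
    have huv' : (u : ℝ) * n + v * r.den = 1 := by
      have h1 : u * (n : ℤ) + v * r.den = 1 := by rw [← huv, hn]
      exact_mod_cast h1
    have h2 : b / r.den = u • a + v • b := by
      rw [zsmul_eq_mul, zsmul_eq_mul]
      calc b / r.den = (u * n + v * r.den) * (b / r.den) := by rw [huv', one_mul]
        _ = u * (n * (b / r.den)) + v * (r.den * (b / r.den)) := by ring
        _ = _ := by rw [← had, ← hbd]
    rw [h2]
    exact add_mem (AddSubgroup.zsmul_mem _ (left_mem_pairGroup a b) u)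
      (AddSubgroup.zsmul_mem _ (right_mem_pairGroup a b) v)
  · rintro e he ⟨x, hx⟩ ⟨y, hy⟩
    have hy0 : 0 < y := by
      have : (0 : ℝ) < y := by
        by_contra h
        nlinarith
      exact_mod_cast this
    have hrxy : r = x / y := by
      have : (r : ℝ) = x / y := by
        rw [← hr, hx, hy, mul_div_mul_right _ _ he.ne']
      exact_mod_cast this
    -- The reduced denominator divides any other one, so e = b/y cannot exceed d.
    have hdvd : (r.den : ℤ) ∣ y := by
      rw [hrxy, ← Rat.divInt_eq_div]
      exact Rat.den_dvd x y
    have hle : (r.den : ℝ) ≤ y := by exact_mod_cast Int.le_of_dvd hy0 hdvd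
    rw [le_div_iff₀ hden, hy, mul_comm]
    gcongr

theorem exists_gcd_and_periodic_limit (hp0 : 0 < p) (hp1 : p < 1)
    (h : ∃ r : ℚ, Real.log p / Real.log (1 - p) = r) :
    ∃ d : ℝ, IsRealGcd (Real.log p) (Real.log (1 - p)) d ∧
      ∃ ψ : ℝ → ℝ,
        (∀ t : ℝ, HasSum (fun k : {k : ℤ // k ≠ 0} =>
            -(1 / (letterEntropy p : ℂ)) *
              (Complex.Gamma (-2 * Real.pi * Complex.I * (k : ℤ) / d) *
                Complex.exp (2 * Real.pi * Complex.I * (k : ℤ) * t / d)))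
          (ψ t : ℂ)) ∧
        Continuous ψ ∧ Function.Periodic ψ d ∧
        Tendsto (fun t => depthError p t - (letterSecondMoment p / (2 * letterEntropy p ^ 2) +
          Real.eulerMascheroniConstant / letterEntropy p + ψ t)) atTop (𝓝 0) := by
  obtain ⟨r, hr⟩ := h
  rw [← neg_div_neg_eq] at hr
  obtain ⟨d, hd, hmem, ⟨n, m, hn, hm⟩, hmax⟩ :=
    exists_common_divisor (neg_log_pos hp0 hp1) (neg_log_one_sub_pos hp0 hp1) hr
  obtain ⟨κ, hκ, hper, hlim⟩ := exists_periodic_depthError hp0 hp1 hd hmem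
  refine ⟨d, ⟨⟨hd, ⟨-n, ?_⟩, ⟨-m, ?_⟩⟩, ?_⟩, fun t => κ t -
    (letterSecondMoment p / (2 * letterEntropy p ^ 2) +
      Real.eulerMascheroniConstant / letterEntropy p),
    hasSum_periodic_limit hp0 hp1 hd hn hm hκ hper hlim, by fun_prop,
    fun t => by simp only [hper t], by simpa using hlim⟩
  · push_cast; linarith
  · push_cast; linarith
  · rintro e ⟨he, ⟨x, hx⟩, ⟨y, hy⟩⟩
    exact hmax e he ⟨-x, by push_cast; linarith⟩ ⟨-y, by push_cast; linarith⟩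

end Cases

/-! ### Depths in tries -/

theorem IsTrieAt.depth?_eq_none {k : ℕ} {S : Set BinString} {t : TrieTree} (h : IsTrieAt k S t)
    {s : BinString} (hs : s ∉ S) : t.depth? s = none := by
  induction h with
  | empty k => rfl
  | leaf k u =>
    have : u ≠ s := fun h => hs (by simp [h])
    simp [TrieTree.depth?, this]
  | node k S l r hS hl hr ihl ihr =>
    simp [TrieTree.depth?, ihl fun h => hs h.1, ihr fun h => hs h.1]

/-- The depth of `s` is the least `m` such that `s` is determined by its next `m` letters. -/
theorem IsTrieAt.exists_depth?_eq_some {k : ℕ} {S : Set BinString} {t : TrieTree}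
    (h : IsTrieAt k S t) {s : BinString} (hs : s ∈ S) (hpre : ∀ u ∈ S, ∀ l < k, u l = s l) :
    ∃ D, t.depth? s = some D ∧
      ∀ m, D ≤ m ↔ ∀ u ∈ S, (∀ l < k + m, u l = s l) → u = s := by
  induction h with
  | empty k => exact absurd hs (Set.notMem_empty s)
  | leaf k u =>
    rw [Set.mem_singleton_iff] at hs
    subst hs
    exact ⟨0, by simp [TrieTree.depth?], by simp⟩
  | node k S l r hS hl hr ihl ihr =>
    -- Passing to a subtree fixes one more letter and costs one edge. The case m = 0 fails because a
    -- nontrivial set holds another string with the same first k letters.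
    have step : ∀ (c : Bool) (D : ℕ), s k = c →
        (∀ m, D ≤ m ↔ ∀ u ∈ {u ∈ S | u k = c}, (∀ l < k + 1 + m, u l = s l) → u = s) →
        ∀ m, D + 1 ≤ m ↔ ∀ u ∈ S, (∀ l < k + m, u l = s l) → u = s := by
      intro c D hc hD m
      cases m with
      | zero =>
        refine iff_of_false (by omega) fun h => ?_
        obtain ⟨u, hu, hne⟩ := hS.exists_ne s
        exact hne (h u hu (hpre u hu))
      | succ m =>
        rw [Nat.succ_le_succ_iff, hD m]
        constructor
        · intro h u hu hul
          exact h u ⟨hu, (hul k (by omega)).trans hc⟩ fun l hl => hul l (by omega)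
        · intro h u hu hul
          exact h u hu.1 fun l hl => hul l (by omega)
    have hpre' : ∀ c : Bool, s k = c → ∀ u ∈ {u ∈ S | u k = c}, ∀ l < k + 1, u l = s l := by
      intro c hc u hu l hl
      rcases Nat.lt_succ_iff_lt_or_eq.1 hl with h | rfl
      · exact hpre u hu.1 l h
      · exact hu.2.trans hc.symm
    cases hc : s k with
    | false =>
      obtain ⟨D, hD, hD'⟩ := ihl ⟨hs, hc⟩ (hpre' _ hc)
      exact ⟨D + 1, by simp [TrieTree.depth?, hD], step _ D hc hD'⟩
    | true =>
      obtain ⟨D, hD, hD'⟩ := ihr ⟨hs, hc⟩ (hpre' _ hc)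
      -- The search tries the left subtree first, so s must be shown absent there.
      have hl' : l.depth? s = none := hl.depth?_eq_none fun h => by simp [hc] at h
      exact ⟨D + 1, by simp [TrieTree.depth?, hD, hl'], step _ D hc hD'⟩

/-- Coinciding strings form one element of the set, so this holds for every sequence, without
distinctness; the default depth 0 is never used for i < n. -/
theorem insertionDepth_le_iff (x : ℕ → BinString) {n i : ℕ} (hi : i < n) (m : ℕ) :
    insertionDepth x n i ≤ m ↔ ∀ j < n, (∀ l < m, x j l = x i l) → x j = x i := by
  have h : IsTrieAt 0 (x '' Set.Iio n) (trieOf (x '' Set.Iio n) ((Set.finite_Iio n).image x)) :=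
    (exists_isTrieAt (x '' Set.Iio n) ((Set.finite_Iio n).image x)).choose_spec
  obtain ⟨D, hD, hD'⟩ := h.exists_depth?_eq_some (s := x i) (Set.mem_image_of_mem x hi)
    (fun u _ l hl => absurd hl (Nat.not_lt_zero l))
  rw [insertionDepth, hD, Option.getD_some, hD' m]
  simp

/-! ### The distribution of prefixes -/

/-- The joint law of the array is a product measure, and currying it gives the product of the row
laws. -/
theorem iIndepFun_curry {ι κ Ω : Type*} {𝓧 : Type*} [MeasurableSpace 𝓧] [MeasurableSpace Ω]
    {P : Measure Ω} [IsProbabilityMeasure P] {X : ι → κ → Ω → 𝓧}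
    (mX : ∀ i j, Measurable (X i j)) (h : iIndepFun (fun ij : ι × κ => X ij.1 ij.2) P) :
    iIndepFun (fun i ω j => X i j ω) P := by
  have hrow : ∀ i, iIndepFun (X i) P := fun i =>
    h.precomp (g := fun j => (i, j)) fun _ _ hj => (Prod.mk.inj hj).2
  have hσ : iIndepFun (fun (ij : (_ : ι) × κ) ω => X ij.1 ij.2 ω) P :=
    h.precomp (Equiv.sigmaEquivProd ι κ).injective
  have h1 : ∀ i j, IsProbabilityMeasure (P.map (X i j)) :=
    fun i j => Measure.isProbabilityMeasure_map (mX i j).aemeasurable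
  have h2 : ∀ i, IsProbabilityMeasure (P.map (fun ω j => X i j ω)) :=
    fun i => Measure.isProbabilityMeasure_map (Measurable.aemeasurable (by fun_prop))
  have h3 : (MeasurableEquiv.piCurry fun (_ : ι) (_ : κ) => 𝓧) ∘
      (fun ω (ij : (_ : ι) × κ) => X ij.1 ij.2 ω) = fun ω i j => X i j ω := by
    ext; simp [Sigma.curry]
  rw [iIndepFun_iff_map_fun_eq_infinitePi_map (by fun_prop)] at hσ ⊢
  rw [← h3, ← Measure.map_map (by fun_prop) (by fun_prop), hσ,
    Measure.infinitePi_map_piCurry (fun i j => P.map (X i j))]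
  congr 1
  funext i
  exact ((iIndepFun_iff_map_fun_eq_infinitePi_map (by fun_prop)).1 (hrow i)).symm

/-- The probability of a word. -/
noncomputable def wordProb (p : ℝ) {m : ℕ} (w : Fin m → Bool) : ℝ :=
  ∏ l, if w l then p else 1 - p

/-- Splitting off the first letter of a word is one application of the operator; this links the
probability to the analysis. -/
theorem sum_wordProb_mul (p : ℝ) (f : ℝ → ℝ) (m : ℕ) : ∀ x : ℝ,
    ∑ w : Fin m → Bool, wordProb p w * f (wordProb p w * x) = (splitOp p)^[m] f x := by
  induction m with
  | zero => intro x; simp [wordProb]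
  | succ m ih =>
    intro x
    rw [splitOp_iterate_succ, ← ih, ← ih, ← (Fin.consEquiv fun _ => Bool).sum_comp,
      Fintype.sum_prod_type, Fintype.sum_bool, Finset.mul_sum, Finset.mul_sum]
    congr 1 <;>
    · refine Finset.sum_congr rfl fun w _ => ?_
      simp only [wordProb, Fin.prod_univ_succ, Fin.consEquiv_apply, Fin.cons_zero, Fin.cons_succ]
      simp only [if_true, if_false, Bool.false_eq_true, mul_assoc, mul_left_comm, mul_comm]

theorem sum_wordProb (p : ℝ) (m : ℕ) : ∑ w : Fin m → Bool, wordProb p w = 1 := by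
  have h := sum_wordProb_mul p (fun _ => 1) m 1
  have h1 : ∀ m : ℕ, ∀ x, (splitOp p)^[m] (fun _ => 1) x = 1 := by
    intro m
    induction m with
    | zero => intro x; rfl
    | succ m ih => intro x; rw [splitOp_iterate_succ, ih, ih]; ring
  simpa [h1] using h

theorem lintegral_natCast_eq_tsum {Ω : Type*} [MeasurableSpace Ω] {P : Measure Ω}
    {X : Ω → ℕ} (hX : Measurable X) :
    ∫⁻ ω, (X ω : ENNReal) ∂P = ∑' m : ℕ, P {ω | m < X ω} := by
  have h1 : ∀ ω, (X ω : ENNReal) = ∑' m : ℕ, {ω | m < X ω}.indicator 1 ω := by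
    intro ω
    rw [tsum_eq_sum (s := Finset.range (X ω)) fun m hm => by simpa using hm,
      Finset.sum_congr rfl fun m hm => Set.indicator_of_mem (by simpa using hm) 1]
    simp
  have hm : ∀ m : ℕ, MeasurableSet {ω | m < X ω} := fun m => hX measurableSet_Ioi
  simp only [h1]
  rw [lintegral_tsum fun m => (measurable_one.indicator (hm m)).aemeasurable]
  exact tsum_congr fun m => lintegral_indicator_one (hm m)

section Prefix

variable {Ω : Type*} [MeasurableSpace Ω] {P : Measure Ω} [IsProbabilityMeasure P] {p : ℝ}
  {ξ : ℕ → ℕ → Ω → Bool}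

theorem measurable_prefix (hmeas : ∀ i j, Measurable (ξ i j)) (m j : ℕ) :
    Measurable fun ω (l : Fin m) => ξ j l ω := measurable_pi_lambda _ fun l => hmeas j l

theorem real_letter_eq (hmeas : ∀ i j, Measurable (ξ i j))
    (hbern : ∀ i j, P.real {ω | ξ i j ω = true} = p) (i j : ℕ) (c : Bool) :
    P.real (ξ i j ⁻¹' {c}) = if c then p else 1 - p := by
  cases c with
  | true => exact (hbern i j).trans (if_pos rfl).symm
  | false =>
    have h1 : ξ i j ⁻¹' {false} = (ξ i j ⁻¹' {true})ᶜ := by ext ω; simp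
    have h2 : P.real (ξ i j ⁻¹' {true}) = p := hbern i j
    rw [h1, probReal_compl_eq_one_sub (hmeas i j (measurableSet_singleton _)), h2]
    simp

theorem real_prefix_eq (hmeas : ∀ i j, Measurable (ξ i j))
    (hindep : iIndepFun (fun ij : ℕ × ℕ => ξ ij.1 ij.2) P)
    (hbern : ∀ i j, P.real {ω | ξ i j ω = true} = p) (j : ℕ) {m : ℕ} (w : Fin m → Bool) :
    P.real ((fun ω (l : Fin m) => ξ j l ω) ⁻¹' {w}) = wordProb p w := by
  have hrow : iIndepFun (fun l : Fin m => ξ j l) P :=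
    hindep.precomp (g := fun l : Fin m => (j, (l : ℕ))) fun _ _ h => Fin.ext (Prod.mk.inj h).2
  have h1 : (fun ω (l : Fin m) => ξ j l ω) ⁻¹' {w} =
      ⋂ l ∈ (Finset.univ : Finset (Fin m)), ξ j l ⁻¹' {w l} := by
    ext ω
    simp [funext_iff]
  rw [h1, measureReal_def, hrow.measure_inter_preimage_eq_mul Finset.univ
    (fun l _ => measurableSet_singleton _), ENNReal.toReal_prod]
  exact Finset.prod_congr rfl fun l _ => real_letter_eq hmeas hbern j l (w l)

/-- The probability that the prefix of one string differs from the prefixes of other strings. -/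
theorem real_forall_prefix_ne (hmeas : ∀ i j, Measurable (ξ i j))
    (hindep : iIndepFun (fun ij : ℕ × ℕ => ξ ij.1 ij.2) P)
    (hbern : ∀ i j, P.real {ω | ξ i j ω = true} = p) {i : ℕ} {J : Finset ℕ} (hi : i ∉ J) (m : ℕ) :
    P.real {ω | ∀ j ∈ J, ∃ l < m, ξ j l ω ≠ ξ i l ω} =
      ∑ w : Fin m → Bool, wordProb p w * (1 - wordProb p w) ^ J.card := by
  set Y : ℕ → Ω → Fin m → Bool := fun j ω l => ξ j l ω with hY
  have hYm : ∀ j, Measurable (Y j) := measurable_prefix hmeas m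
  have hYind : iIndepFun Y P := (iIndepFun_curry hmeas hindep).comp
    (fun _ x (l : Fin m) => x l) fun _ => by fun_prop
  have hne : ∀ j ω, (∃ l < m, ξ j l ω ≠ ξ i l ω) ↔ Y j ω ≠ Y i ω := by
    intro j ω
    rw [Function.ne_iff]
    exact ⟨fun ⟨l, hl, h⟩ => ⟨⟨l, hl⟩, h⟩, fun ⟨l, h⟩ => ⟨l, l.2, h⟩⟩
  -- For a fixed prefix w of string i, the event is an intersection over the independent strings:
  -- string i starts with w and the others do not.
  set B : (Fin m → Bool) → ℕ → Set (Fin m → Bool) := fun w j => if j = i then {w} else {w}ᶜ with hB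
  have hset : {ω | ∀ j ∈ J, ∃ l < m, ξ j l ω ≠ ξ i l ω} =
      ⋃ w ∈ (Finset.univ : Finset (Fin m → Bool)), ⋂ j ∈ insert i J, Y j ⁻¹' B w j := by
    ext ω
    simp only [Set.mem_ofPred_eq, hne, Finset.mem_univ, Set.iUnion_true, Set.mem_iUnion,
      Set.mem_iInter, Finset.mem_insert, forall_eq_or_imp, Set.mem_preimage]
    have hBi : ∀ w, B w i = {w} := fun w => by simp [hB]
    have hBj : ∀ w, ∀ j ∈ J, B w j = {w}ᶜ := fun w j hj => by
      have : j ≠ i := fun h => hi (h ▸ hj)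
      simp [hB, this]
    constructor
    · intro h
      exact ⟨Y i ω, by simp [hBi], fun j hj => by rw [hBj _ j hj]; exact h j hj⟩
    · rintro ⟨w, h1, h2⟩ j hj
      rw [hBi] at h1
      have h3 := h2 j hj
      rw [hBj _ j hj] at h3
      rw [Set.mem_singleton_iff.1 h1]
      exact h3
  have hBm : ∀ w j, MeasurableSet (B w j) := fun w j => Set.Finite.measurableSet (Set.toFinite _)
  rw [hset, measureReal_biUnion_finset]
  · refine Finset.sum_congr rfl fun w _ => ?_
    rw [measureReal_def, hYind.measure_inter_preimage_eq_mul _ (fun j _ => hBm w j),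
      Finset.prod_insert hi, ENNReal.toReal_mul, ENNReal.toReal_prod]
    have h1 : (P (Y i ⁻¹' B w i)).toReal = wordProb p w := by
      simp only [hB, if_true]
      exact real_prefix_eq hmeas hindep hbern i w
    have h2 : ∀ j ∈ J, (P (Y j ⁻¹' B w j)).toReal = 1 - wordProb p w := by
      intro j hj
      have hji : j ≠ i := fun h => hi (h ▸ hj)
      have h3 := real_prefix_eq hmeas hindep hbern j w
      simp only [hB, if_neg hji, Set.preimage_compl]
      rw [← measureReal_def, probReal_compl_eq_one_sub (hYm j (measurableSet_singleton _)), h3]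
    rw [h1, Finset.prod_congr rfl h2, Finset.prod_const]
  · intro w _ w' _ hww'
    refine Set.disjoint_left.2 fun ω h1 h2 => hww' ?_
    have h3 := Set.mem_iInter₂.1 h1 i (Finset.mem_insert_self i J)
    have h4 := Set.mem_iInter₂.1 h2 i (Finset.mem_insert_self i J)
    simp only [hB, if_true, Set.mem_preimage, Set.mem_singleton_iff] at h3 h4
    exact h3.symm.trans h4
  · exact fun w _ => Finset.measurableSet_biInter _ fun j _ => hYm j (hBm w j)

theorem measurableSet_prefix_eq (hmeas : ∀ i j, Measurable (ξ i j)) (i j m : ℕ) :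
    MeasurableSet {ω | ∀ l < m, ξ j l ω = ξ i l ω} := by
  have : {ω | ∀ l < m, ξ j l ω = ξ i l ω} = ⋂ l ∈ Set.Iio m, {ω | ξ j l ω = ξ i l ω} := by
    ext; simp
  rw [this]
  exact MeasurableSet.biInter (Set.to_countable _) fun l _ =>
    measurableSet_eq_fun (hmeas j l) (hmeas i l)

theorem real_exists_prefix_eq (hmeas : ∀ i j, Measurable (ξ i j))
    (hindep : iIndepFun (fun ij : ℕ × ℕ => ξ ij.1 ij.2) P)
    (hbern : ∀ i j, P.real {ω | ξ i j ω = true} = p) {i : ℕ} {J : Finset ℕ} (hi : i ∉ J) (m : ℕ) :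
    P.real {ω | ∃ j ∈ J, ∀ l < m, ξ j l ω = ξ i l ω} =
      (splitOp p)^[m] (fun x => 1 - (1 - x) ^ J.card) 1 := by
  have hset : {ω | ∃ j ∈ J, ∀ l < m, ξ j l ω = ξ i l ω} =
      {ω | ∀ j ∈ J, ∃ l < m, ξ j l ω ≠ ξ i l ω}ᶜ := by
    ext ω; simp
  have hmS : MeasurableSet {ω | ∀ j ∈ J, ∃ l < m, ξ j l ω ≠ ξ i l ω} := by
    have : {ω | ∀ j ∈ J, ∃ l < m, ξ j l ω ≠ ξ i l ω} =
        ⋂ j ∈ J, {ω | ∀ l < m, ξ j l ω = ξ i l ω}ᶜ := by ext; simp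
    rw [this]
    exact Finset.measurableSet_biInter _ fun j _ => (measurableSet_prefix_eq hmeas i j m).compl
  rw [hset, probReal_compl_eq_one_sub hmS, real_forall_prefix_ne hmeas hindep hbern hi,
    ← sum_wordProb_mul]
  simp only [mul_one, mul_sub, Finset.sum_sub_distrib, sum_wordProb]

/-- Two strings agree on m letters with probability (p²+q²)ᵐ, which tends to 0. -/
theorem ae_string_ne (hp0 : 0 < p) (hp1 : p < 1) (hmeas : ∀ i j, Measurable (ξ i j))
    (hindep : iIndepFun (fun ij : ℕ × ℕ => ξ ij.1 ij.2) P)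
    (hbern : ∀ i j, P.real {ω | ξ i j ω = true} = p) {i j : ℕ} (hij : j ≠ i) :
    ∀ᵐ ω ∂P, (fun l => ξ j l ω) ≠ fun l => ξ i l ω := by
  have hle : ∀ m : ℕ, P.real {ω | (fun l => ξ j l ω) = fun l => ξ i l ω} ≤
      (p ^ 2 + (1 - p) ^ 2) ^ m := by
    intro m
    have h := real_exists_prefix_eq hmeas hindep hbern
      (J := {j}) (fun h => hij (Finset.mem_singleton.1 h).symm) m
    simp only [Finset.card_singleton, pow_one, sub_sub_cancel, splitOp_iterate_id, mul_one] at h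
    rw [← h]
    refine measureReal_mono fun ω hω => ?_
    exact ⟨j, Finset.mem_singleton_self j, fun l _ => congrFun hω l⟩
  have h0 : P.real {ω | (fun l => ξ j l ω) = fun l => ξ i l ω} = 0 :=
    le_antisymm (ge_of_tendsto' (tendsto_pow_atTop_nhds_zero_of_lt_one sq_add_sq_one_sub_nonneg
      (sq_add_sq_one_sub_lt_one hp0 hp1)) hle) measureReal_nonneg
  rw [measureReal_eq_zero_iff] at h0
  simpa [ae_iff] using h0

/-- The tail of the insertion depth. -/
theorem measure_lt_insertionDepth (hp0 : 0 < p) (hp1 : p < 1) (hmeas : ∀ i j, Measurable (ξ i j))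
    (hindep : iIndepFun (fun ij : ℕ × ℕ => ξ ij.1 ij.2) P)
    (hbern : ∀ i j, P.real {ω | ξ i j ω = true} = p) {n i : ℕ} (hi : i < n) (m : ℕ) :
    P {ω | m < insertionDepth (fun a l => ξ a l ω) n i} =
      ENNReal.ofReal ((splitOp p)^[m] (trieWeight n) 1) := by
  have hJ : i ∉ (Finset.range n).erase i := Finset.notMem_erase i _
  have hcard : ((Finset.range n).erase i).card = n - 1 := by
    rw [Finset.card_erase_of_mem (Finset.mem_range.2 hi), Finset.card_range]
  have h := real_exists_prefix_eq hmeas hindep hbern hJ m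
  rw [hcard] at h
  change _ = (splitOp p)^[m] (trieWeight n) 1 at h
  rw [← h, ofReal_measureReal]
  refine measure_congr ?_
  have hae : ∀ᵐ ω ∂P, ∀ j : ℕ, j ≠ i → (fun l => ξ j l ω) ≠ fun l => ξ i l ω := by
    rw [ae_all_iff]
    intro j
    by_cases hij : j = i
    · exact Eventually.of_forall fun ω h => absurd hij h
    · filter_upwards [ae_string_ne hp0 hp1 hmeas hindep hbern hij] with ω hω _ using hω
  filter_upwards [hae] with ω hω
  refine propext ?_
  change m < insertionDepth (fun a l => ξ a l ω) n i ↔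
    ∃ j ∈ (Finset.range n).erase i, ∀ l < m, ξ j l ω = ξ i l ω
  rw [← not_le, insertionDepth_le_iff _ hi]
  push Not
  constructor
  · rintro ⟨j, hj, hl, hne⟩
    exact ⟨j, Finset.mem_erase.2 ⟨fun h => hne (by rw [h]), Finset.mem_range.2 hj⟩, hl⟩
  · rintro ⟨j, hj, hl⟩
    rw [Finset.mem_erase, Finset.mem_range] at hj
    exact ⟨j, hj.2, hl, hω j hj.1⟩

/-- The trie comes from a choice, so measurability has to pass through the prefix characterization
of the depth. -/
theorem measurable_insertionDepth (hmeas : ∀ i j, Measurable (ξ i j)) {n i : ℕ} (hi : i < n) :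
    Measurable fun ω => insertionDepth (fun a l => ξ a l ω) n i := by
  refine measurable_of_Iic fun m => ?_
  have : (fun ω => insertionDepth (fun a l => ξ a l ω) n i) ⁻¹' Set.Iic m =
      ⋂ j ∈ Set.Iio n, ({ω | ∀ l < m, ξ j l ω = ξ i l ω}ᶜ ∪
        ⋂ l, {ω | ξ j l ω = ξ i l ω}) := by
    ext ω
    simp only [Set.mem_preimage, Set.mem_Iic, insertionDepth_le_iff _ hi, Set.mem_iInter,
      Set.mem_Iio, Set.mem_union, Set.mem_compl_iff, Set.mem_ofPred_eq, funext_iff,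
      imp_iff_not_or]
  rw [this]
  exact MeasurableSet.biInter (Set.to_countable _) fun j _ =>
    (measurableSet_prefix_eq hmeas i j m).compl.union
      (MeasurableSet.iInter fun l => measurableSet_eq_fun (hmeas j l) (hmeas i l))

/-- The mean insertion depth. -/
theorem integrable_insertionDepth (hp0 : 0 < p) (hp1 : p < 1) (hmeas : ∀ i j, Measurable (ξ i j))
    (hindep : iIndepFun (fun ij : ℕ × ℕ => ξ ij.1 ij.2) P)
    (hbern : ∀ i j, P.real {ω | ξ i j ω = true} = p) {n i : ℕ} (hi : i < n) :
    Integrable (fun ω => (insertionDepth (fun a l => ξ a l ω) n i : ℝ)) P ∧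
      ∫ ω, (insertionDepth (fun a l => ξ a l ω) n i : ℝ) ∂P = splitSum p (trieWeight n) 1 := by
  have hX := measurable_insertionDepth hmeas hi
  have hb : ∀ y, 0 ≤ y → y ≤ 1 → |trieWeight n y| ≤ n * y := fun y => abs_trieWeight_le
  have h0 : ∀ m, 0 ≤ (splitOp p)^[m] (trieWeight n) 1 := fun m =>
    splitOp_iterate_nonneg hp0 hp1 m zero_le_one fun y hy hy1 =>
      sub_nonneg.2 (pow_le_one₀ (by linarith) (by linarith))
  have hl : ∫⁻ ω, (insertionDepth (fun a l => ξ a l ω) n i : ENNReal) ∂P =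
      ENNReal.ofReal (splitSum p (trieWeight n) 1) := by
    rw [lintegral_natCast_eq_tsum hX, splitSum, ENNReal.ofReal_tsum_of_nonneg h0
      (summable_splitOp_iterate hp0 hp1 zero_le_one hb)]
    exact tsum_congr fun m => measure_lt_insertionDepth hp0 hp1 hmeas hindep hbern hi m
  have hXr : Measurable fun ω => (insertionDepth (fun a l => ξ a l ω) n i : ℝ) :=
    measurable_from_nat.comp hX
  constructor
  · refine ⟨hXr.aestronglyMeasurable, ?_⟩
    rw [hasFiniteIntegral_iff_ofReal (Eventually.of_forall fun ω => Nat.cast_nonneg _)]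
    simp only [ENNReal.ofReal_natCast, hl, ENNReal.ofReal_lt_top]
  · rw [integral_eq_lintegral_of_nonneg_ae (Eventually.of_forall fun ω => Nat.cast_nonneg _)
      hXr.aestronglyMeasurable]
    simp only [ENNReal.ofReal_natCast, hl]
    exact ENNReal.toReal_ofReal (tsum_nonneg h0)

end Prefix

theorem mainTheorem2 {Ω : Type*} [MeasurableSpace Ω] (P : Measure Ω) [IsProbabilityMeasure P]
    (p : ℝ) (hp0 : 0 < p) (hp1 : p < 1)
    -- `ξ i j` is the letter number `j` of the string number `i`; all letters are i.i.d. `Be(p)`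
    (ξ : ℕ → ℕ → Ω → Bool)
    (hmeas : ∀ i j, Measurable (ξ i j))
    (hindep : iIndepFun (fun ij : ℕ × ℕ => ξ ij.1 ij.2) P)
    (hbern : ∀ i j, P.real {ω | ξ i j ω = true} = p)
    -- among the first `n` strings, the string number `i n` is chosen
    (i : ℕ → ℕ) (hi : ∀ n, 1 ≤ n → i n < n)
    (D : ℕ → Ω → ℕ)
    (hD : ∀ n ω, D n ω = insertionDepth (fun m j => ξ m j ω) n (i n)) :
    (∀ n, 1 ≤ n → Integrable (fun ω => (D n ω : ℝ)) P) ∧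
    (Irrational (Real.log p / Real.log (1 - p)) →
      Tendsto (fun n : ℕ => (∫ ω, (D n ω : ℝ) ∂P) -
          (Real.log n / letterEntropy p + letterSecondMoment p / (2 * letterEntropy p ^ 2)
            + Real.eulerMascheroniConstant / letterEntropy p))
        atTop (𝓝 0)) ∧
    ((∃ r : ℚ, Real.log p / Real.log (1 - p) = r) →
      ∃ d : ℝ, IsRealGcd (Real.log p) (Real.log (1 - p)) d ∧
      ∃ ψ : ℝ → ℝ,
        (∀ t : ℝ, HasSum (fun k : {k : ℤ // k ≠ 0} =>
            -(1 / (letterEntropy p : ℂ)) *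
              (Complex.Gamma (-2 * Real.pi * Complex.I * (k : ℤ) / d) *
                Complex.exp (2 * Real.pi * Complex.I * (k : ℤ) * t / d)))
          (ψ t : ℂ)) ∧
        Continuous ψ ∧ Function.Periodic ψ d ∧
        Tendsto (fun n : ℕ => (∫ ω, (D n ω : ℝ) ∂P) -
            (Real.log n / letterEntropy p + letterSecondMoment p / (2 * letterEntropy p ^ 2)
              + Real.eulerMascheroniConstant / letterEntropy p + ψ (Real.log n)))
          atTop (𝓝 0)) := by
  have hmean : ∀ n, 1 ≤ n → Integrable (fun ω => (D n ω : ℝ)) P ∧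
      ∫ ω, (D n ω : ℝ) ∂P = splitSum p (trieWeight n) 1 := by
    intro n hn
    simp only [hD]
    exact integrable_insertionDepth hp0 hp1 hmeas hindep hbern (hi n hn)
  have hlog : Tendsto (fun n : ℕ => Real.log n) atTop atTop :=
    Real.tendsto_log_atTop.comp tendsto_natCast_atTop_atTop
  -- Common to both cases: depoissonization plus the asymptotics of the error at t = ln n.
  have hdep : ∀ f : ℝ → ℝ, Tendsto (fun t => depthError p t - f t) atTop (𝓝 0) →
      Tendsto (fun n : ℕ => (∫ ω, (D n ω : ℝ) ∂P) -
        (Real.log n / letterEntropy p + f (Real.log n))) atTop (𝓝 0) := by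
    intro f hf
    have h := (tendsto_splitSum_trieWeight_sub hp0 hp1).add (hf.comp hlog)
    rw [add_zero] at h
    refine h.congr' ?_
    filter_upwards [eventually_ge_atTop 1] with n hn
    have hn0 : (0 : ℝ) < n := by exact_mod_cast hn
    simp only [(hmean n hn).2, Function.comp, depthError, Real.exp_log hn0]
    ring
  refine ⟨fun n hn => (hmean n hn).1, fun hirr => ?_, fun hrat => ?_⟩
  · refine (hdep (fun _ => letterSecondMoment p / (2 * letterEntropy p ^ 2) +
      Real.eulerMascheroniConstant / letterEntropy p) ?_).congr fun n => by ring
    exact tendsto_sub_nhds_zero_iff.2 (tendsto_depthError_of_irrational hp0 hp1 hirr)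
  · obtain ⟨d, hd, ψ, hsum, hcont, hper, hlim⟩ := exists_gcd_and_periodic_limit hp0 hp1 hrat
    exact ⟨d, hd, ψ, hsum, hcont, hper, (hdep _ hlim).congr fun n => by ring⟩
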